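/- Let $X$ be a locally compact, geodesically complete CAT(0) space (complete by definition) that is connected at infinity, i.e. the complement of every metric ball is path connected. Geodesics are parametrized by arc length. Let $\partial_\infty X$ be the geometric boundary of $X$ (classes of geodesic rays at finite Hausdorff distance) with the cone topology; for a complete geodesic $c$ write $c(\pm\infty)\in\partial_\infty X$ for its two ends. A complete geodesic $a$ has strictly rank one if there is no finite sequence of complete geodesics $a=a_0,a_1,\dots,a_n$ ($n\ge 0$) such that $a_{i-1}$ and $a_i$ contain asymptotic rays for $1\le i\le n$ and $a_n$ is a boundary geodesic of a flat strip (a subset of $X$ isometric to $\mathbb R\times[0,w]$, $w>0$). Complete geodesics $a,b,c,d$ form scissors $\langle a,b,c,d;x\rangle$ with lowest base $a$ and center $x\in X$ if $a(-\infty)=b(-\infty)$, $a(+\infty)=c(+\infty)$, $c(-\infty)=d(-\infty)$, $b(+\infty)=d(+\infty)$ and $b\cap c=\{x\}$. For complete geodesics $c_1,c_2$ with a common end $\xi$, let $R_{c_1c_2}\colon c_1\to c_2$ send $m$ to the unique point $m'\in c_2$ with $\beta_\xi(m')=\beta_\xi(m)$, where $\beta_\xi(y)=\lim_{t\to\infty}(|y\,r(t)|-t)$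 is a Busemann function of $\xi$, $r$ being a ray in the class $\xi$. The ends used for $R_{ac},R_{cd},R_{db},R_{ba}$ are $a(+\infty),c(-\infty),d(+\infty),b(-\infty)$, respectively. The scissors translation is $T=R_{ba}\circ R_{db}\circ R_{cd}\circ R_{ac}\colon a\to a$, and its displacement is $\delta T=\beta_{a(-\infty)}(T(m))-\beta_{a(-\infty)}(m)$, which does not depend on $m\in a$. **Theorem.** Fix a complete geodesic $a$ of strictly rank one in $X$, and let $Z(a)\subset\partial_\infty X\times\partial_\infty X\times X$ be the set of all triples $(\xi,\eta,x)$ for which there exist scissors $\langle a,b,c,d;x\rangle$ with $b(+\infty)=\xi$ and $c(-\infty)=\eta$. Then $\delta T$ depends only on the triple $(b(+\infty),c(-\infty),x)$, and the resulting function $\delta\colon Z(a)\to\mathbb R$ is continuous for the topology induced from $\partial_\infty X\times\partial_\infty X\times X$. -/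

import Mathlib

open Set Filter Topology
open scoped NNReal

namespace Scissors

section Spaces

variable {X : Type*} [MetricSpace X]

/-- `c`, restricted to `[0, dist p q]`, is a minimizing geodesic segment from `p` to `q`. -/
def IsMinimizing (c : ℝ → X) (p q : X) : Prop :=
  c 0 = p ∧ c (dist p q) = q ∧
    ∀ s ∈ Icc 0 (dist p q), ∀ t ∈ Icc 0 (dist p q), dist (c s) (c t) = |s - t|

/-- A complete geodesic, parametrized by arc length. In a CAT(0) space every local geodesic is
minimizing, so that complete geodesics are the isometric embeddings of the real line. -/
structure GeodesicLine (X : Type*) [MetricSpace X] where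
  toFun : ℝ → X
  isometry : Isometry toFun

/-- A geodesic ray, parametrized by arc length. -/
structure GeodesicRay (X : Type*) [MetricSpace X] where
  toFun : ℝ≥0 → X
  isometry : Isometry toFun

/-- The image of a complete geodesic. -/
def GeodesicLine.image (c : GeodesicLine X) : Set X := range c.toFun

/-- The image of a geodesic ray. -/
def GeodesicRay.image (r : GeodesicRay X) : Set X := range r.toFun

variable (X) in
/-- CAT(0) spaces: complete geodesic spaces in which every geodesic triangle is at least as thin
as its comparison triangle in the Euclidean plane. Two different sides of a triangle always have
a common vertex, here called `p`; `x'`, `y'` are the comparison points of `c₁ s`, `c₂ t`. -/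
structure IsCAT0 : Prop where
  complete : CompleteSpace X
  geodesic : ∀ p q : X, ∃ c : ℝ → X, IsMinimizing c p q
  comparison : ∀ (p q r : X) (c₁ c₂ : ℝ → X), IsMinimizing c₁ p q → IsMinimizing c₂ p r →
    ∀ s ∈ Icc 0 (dist p q), ∀ t ∈ Icc 0 (dist p r),
    ∀ p' q' r' x' y' : EuclideanSpace ℝ (Fin 2),
      dist p' q' = dist p q → dist p' r' = dist p r → dist q' r' = dist q r →
      dist p' x' = s → dist x' q' = dist p q - s →
      dist p' y' = t → dist y' r' = dist p r - t →
      dist (c₁ s) (c₂ t) ≤ dist x' y'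

variable (X) in
/-- Every geodesic segment is contained in some complete geodesic. -/
def GeodesicallyComplete : Prop :=
  ∀ (p q : X) (c : ℝ → X), IsMinimizing c p q →
    ∃ γ : GeodesicLine X, c '' Icc 0 (dist p q) ⊆ γ.image

variable (X) in
/-- The complement of every metric ball is path connected. -/
def ConnectedAtInfinity : Prop :=
  ∀ (x : X) (ρ : ℝ), IsPathConnected (Metric.ball x ρ)ᶜ

/-- Two rays are asymptotic if their Hausdorff distance is finite. -/
def GeodesicRay.Asymptotic (r₁ r₂ : GeodesicRay X) : Prop :=
  Metric.hausdorffEDist r₁.image r₂.image ≠ ⊤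

instance raySetoid (X : Type*) [MetricSpace X] : Setoid (GeodesicRay X) where
  r := GeodesicRay.Asymptotic
  iseqv :=
    { refl := fun r => by simp [GeodesicRay.Asymptotic]
      symm := fun {r s} h => by
        unfold GeodesicRay.Asymptotic at *
        rwa [Metric.hausdorffEDist_comm]
      trans := fun {r s t} h₁ h₂ => by
        unfold GeodesicRay.Asymptotic at *
        exact ne_top_of_le_ne_top (ENNReal.add_ne_top.2 ⟨h₁, h₂⟩)
          Metric.hausdorffEDist_triangle }

/-- The geometric boundary: classes of asymptotic rays. -/
def Boundary (X : Type*) [MetricSpace X] : Type _ := Quotient (raySetoid X)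

/-- The ideal point of a ray. -/
def GeodesicRay.endpoint (r : GeodesicRay X) : Boundary X := Quotient.mk (raySetoid X) r

/-- The basic set of the cone topology given by `ξ`, `x₀`, `K`, `ε`: all `η` such that the rays
from `x₀` to `ξ` and to `η` have distance less than `ε` at time `K`. -/
def coneNhd (ξ : Boundary X) (x₀ : X) (K : ℝ≥0) (ε : ℝ) : Set (Boundary X) :=
  {η | ∃ r s : GeodesicRay X, r.toFun 0 = x₀ ∧ s.toFun 0 = x₀ ∧ r.endpoint = ξ ∧
    s.endpoint = η ∧ dist (r.toFun K) (s.toFun K) < ε}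

/-- The cone topology. -/
instance coneTopology (X : Type*) [MetricSpace X] : TopologicalSpace (Boundary X) :=
  TopologicalSpace.generateFrom
    {U | ∃ (ξ : Boundary X) (x₀ : X) (K : ℝ≥0) (ε : ℝ), 0 < K ∧ 0 < ε ∧ U = coneNhd ξ x₀ K ε}

/-- The ray `t ↦ c t`, `t ≥ 0`. -/
def GeodesicLine.posRay (c : GeodesicLine X) : GeodesicRay X where
  toFun t := c.toFun t
  isometry := c.isometry.comp isometry_subtype_coe

/-- The ray `t ↦ c (-t)`, `t ≥ 0`. -/
def GeodesicLine.negRay (c : GeodesicLine X) : GeodesicRay X where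
  toFun t := c.toFun (-(t : ℝ))
  isometry := c.isometry.comp ((IsometryEquiv.neg ℝ).isometry.comp isometry_subtype_coe)

/-- The ideal point `c(+∞)`. -/
def GeodesicLine.posEnd (c : GeodesicLine X) : Boundary X := c.posRay.endpoint

/-- The ideal point `c(-∞)`. -/
def GeodesicLine.negEnd (c : GeodesicLine X) : Boundary X := c.negRay.endpoint

/-- Complete geodesics are asymptotic if they contain asymptotic rays. -/
def GeodesicLine.Asymptotic (c₁ c₂ : GeodesicLine X) : Prop :=
  ∃ r₁ r₂ : GeodesicRay X, r₁.image ⊆ c₁.image ∧ r₂.image ⊆ c₂.image ∧ r₁.Asymptotic r₂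

/-- `c` is a boundary geodesic of a flat strip, an isometric copy of `ℝ × [0, w]` with `w > 0`. -/
def GeodesicLine.BoundsFlatStrip (c : GeodesicLine X) : Prop :=
  ∃ w : ℝ, 0 < w ∧ ∃ F : EuclideanSpace ℝ (Fin 2) → X,
    (∀ p q : EuclideanSpace ℝ (Fin 2), p 1 ∈ Icc 0 w → q 1 ∈ Icc 0 w →
      dist (F p) (F q) = dist p q) ∧
    ∀ t : ℝ, F !₂[t, 0] = c.toFun t

/-- A finite chain of consecutively asymptotic geodesics leads from `c` to a geodesic that bounds
a flat strip. -/
def GeodesicLine.VirtuallyBoundsFlatStrip (c : GeodesicLine X) : Prop :=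
  ∃ c' : GeodesicLine X,
    Relation.ReflTransGen GeodesicLine.Asymptotic c c' ∧ c'.BoundsFlatStrip

/-- Geodesics of strictly rank one. -/
def GeodesicLine.StrictlyRankOne (c : GeodesicLine X) : Prop := ¬ c.VirtuallyBoundsFlatStrip

/-- The Busemann function `x ↦ lim (|x r(t)| - t)` of a ray. -/
noncomputable def busemann (r : GeodesicRay X) (x : X) : ℝ :=
  limUnder atTop (fun t : ℝ≥0 => dist x (r.toFun t) - (t : ℝ))

/-- The limit that defines the Busemann function always exists. -/
theorem tendsto_busemann (r : GeodesicRay X) (x : X) :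
    Tendsto (fun t : ℝ≥0 => dist x (r.toFun t) - (t : ℝ)) atTop (𝓝 (busemann r x)) := by
  have hanti : Antitone (fun t : ℝ≥0 => dist x (r.toFun t) - (t : ℝ)) := by
    intro s t hst
    have h1 := dist_triangle x (r.toFun s) (r.toFun t)
    have h2 : dist (r.toFun s) (r.toFun t) = (t : ℝ) - s := by
      rw [r.isometry.dist_eq, NNReal.dist_eq, abs_sub_comm, abs_of_nonneg]
      exact sub_nonneg.2 (NNReal.coe_le_coe.2 hst)
    show dist x (r.toFun t) - (t : ℝ) ≤ dist x (r.toFun s) - (s : ℝ)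
    linarith
  have hbdd : BddBelow (range (fun t : ℝ≥0 => dist x (r.toFun t) - (t : ℝ))) := by
    refine ⟨-dist x (r.toFun 0), ?_⟩
    rintro _ ⟨t, rfl⟩
    have h1 := dist_triangle (r.toFun 0) x (r.toFun t)
    have h2 : dist (r.toFun 0) (r.toFun t) = (t : ℝ) := by
      rw [r.isometry.dist_eq, NNReal.dist_eq]
      simp
    rw [dist_comm (r.toFun 0) x] at h1
    show -dist x (r.toFun 0) ≤ dist x (r.toFun t) - (t : ℝ)
    linarith
  have h := tendsto_atTop_ciInf hanti hbdd
  rw [busemann, h.limUnder_eq]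
  exact h

open Classical in
/-- Metric transfer to the geodesic `c` along the horospheres of the ray `r`: the point `m'` of `c`
with the same value of the Busemann function as `m`. It exists and is unique in a CAT(0) space if
the ideal point of `r` is an end of `c`. -/
noncomputable def transfer (r : GeodesicRay X) (c : GeodesicLine X) (m : X) : X :=
  if h : ∃ m' ∈ c.image, busemann r m' = busemann r m then h.choose else m

/-- `⟨a, b, c, d; x⟩` are scissors with lowest base `a` and center `x`. -/
structure IsScissors (a b c d : GeodesicLine X) (x : X) : Prop where
  a_neg_b : a.negEnd = b.negEnd
  a_pos_c : a.posEnd = c.posEnd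
  c_neg_d : c.negEnd = d.negEnd
  b_pos_d : b.posEnd = d.posEnd
  inter : b.image ∩ c.image = {x}

/-- The scissors translation `T = R_ba ∘ R_db ∘ R_cd ∘ R_ac`. -/
noncomputable def scissorsTranslation (a b c d : GeodesicLine X) : X → X :=
  transfer b.negRay a ∘ transfer d.posRay b ∘ transfer c.negRay d ∘ transfer a.posRay c

/-- The displacement `β(T m) - β(m)` of the scissors translation at a point `m` of the lowest base
`a`, where `β` is the Busemann function of `a(-∞)`. -/
noncomputable def displacementAt (a b c d : GeodesicLine X) (m : X) : ℝ :=
  busemann a.negRay (scissorsTranslation a b c d m) - busemann a.negRay m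

/-- The set `Z(a)` of triples `(b(+∞), c(-∞), x)` realised by scissors with lowest base `a`. -/
def scissorsTriples (a : GeodesicLine X) : Set (Boundary X × Boundary X × X) :=
  {z | ∃ b c d : GeodesicLine X, IsScissors a b c d z.2.2 ∧ b.posEnd = z.1 ∧ c.negEnd = z.2.1}

end Spaces

end Scissors

/-! For a complete geodesic `c` let S_c be the sum of the Busemann functions of its two ends,
normalized to vanish on `c`. Busemann functions of asymptotic rays differ by a constant
(`IsCAT0.busemann_sub_eq`), so S_c depends only on the ends of `c` (`IsCAT0.busemannSum_eq`).
Following a point around the scissors gives δT = S_a(x) + S_d(x) - S_b(x) - S_c(x), and the last two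
terms vanish because x lies on `b` and `c`. Since the ends of `d` are b(+∞) and c(-∞), δT is a
function of the triple.

S_a is continuous, so continuity concerns S_d only. The chain a, c, d shows that `d` bounds no flat
strip. Geodesics with ends close to those of `d` must then pass near d(0)
(`IsCAT0.eventually_exists_near`). Otherwise segments between neighbourhoods of the two ends would
miss a ball around d(0), and an intermediate value argument would give long segments that avoid the
open ball but stay uniformly close to `d`. Their limit is a parallel of `d` missing d(0), contrary
to the flat strip theorem. Hence geodesics whose ends converge to those of `d` converge, after a
shift and along an ultrafilter, to a parallel of `d`, and Busemann functions pass to such limits. -/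

namespace Scissors

section CAT0

variable {X : Type*} [MetricSpace X]

/-! ### Quadratic inequalities and convexity of the metric -/

/-- `z` divides a segment from `p` to `q` in the ratio `l : 1 - l`. -/
def DivPoint (l : ℝ) (p q z : X) : Prop :=
  dist p z = l * dist p q ∧ dist z q = (1 - l) * dist p q

theorem DivPoint.symm {l : ℝ} {p q z : X} (h : DivPoint l p q z) : DivPoint (1 - l) q p z := by
  refine ⟨?_, ?_⟩
  · rw [dist_comm q z, dist_comm q p, h.2]
  · rw [dist_comm z p, dist_comm q p, h.1]; ring

theorem divPoint_zero (p q : X) : DivPoint 0 p q p := by simp [DivPoint]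

theorem IsMinimizing.divPoint {c : ℝ → X} {p q : X} (h : IsMinimizing c p q) {l : ℝ}
    (hl : l ∈ Icc (0 : ℝ) 1) : DivPoint l p q (c (l * dist p q)) := by
  obtain ⟨h0, h1, h2⟩ := h
  have hd : 0 ≤ dist p q := dist_nonneg
  have hm : l * dist p q ∈ Icc 0 (dist p q) :=
    ⟨mul_nonneg hl.1 hd, by nlinarith [hl.2]⟩
  refine ⟨?_, ?_⟩
  · have := h2 0 ⟨le_rfl, hd⟩ _ hm
    rw [h0] at this
    rw [this, zero_sub, abs_neg, abs_of_nonneg hm.1]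
  · have := h2 _ hm (dist p q) ⟨hd, le_rfl⟩
    rw [h1] at this
    rw [this, abs_sub_comm, abs_of_nonneg (by linarith [hm.2])]
    ring

theorem IsCAT0.exists_divPoint (hX : IsCAT0 X) (p q : X) {l : ℝ} (hl : l ∈ Icc (0 : ℝ) 1) :
    ∃ z, DivPoint l p q z := by
  obtain ⟨c, hc⟩ := hX.geodesic p q
  exact ⟨_, hc.divPoint hl⟩

theorem dist_sq_plane (x y z w : ℝ) :
    dist (!₂[x, y] : EuclideanSpace ℝ (Fin 2)) !₂[z, w] = √((x - z) ^ 2 + (y - w) ^ 2) := by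
  simp [EuclideanSpace.dist_eq, Real.dist_eq, sq_abs]

theorem IsCAT0.cn_minimizing (hX : IsCAT0 X) {p q : X} (x : X) {c : ℝ → X}
    (hc : IsMinimizing c p q) {l : ℝ} (hl : l ∈ Icc (0 : ℝ) 1) :
    dist x (c (l * dist p q)) ^ 2 ≤
      (1 - l) * dist x p ^ 2 + l * dist x q ^ 2 - l * (1 - l) * dist p q ^ 2 := by
  rcases eq_or_ne p q with rfl | hpq
  · simp only [dist_self, mul_zero, hc.1]
    nlinarith
  obtain ⟨c₁, hc₁⟩ := hX.geodesic p x
  have hR : 0 < dist p q := dist_pos.2 hpq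
  set R := dist p q with hRdef
  set Q := dist p x with hQdef
  set S := dist x q with hSdef
  have hQ : 0 ≤ Q := dist_nonneg
  have hS : 0 ≤ S := dist_nonneg
  have t1 : R ≤ Q + S := dist_triangle p x q
  have t2 : Q ≤ R + S := by
    have := dist_triangle p q x; rwa [dist_comm q x] at this
  have t3 : S ≤ Q + R := by
    have := dist_triangle x p q; rwa [dist_comm x p] at this
  set u := (Q ^ 2 + R ^ 2 - S ^ 2) / (2 * R) with hu
  have huR : 2 * R * u = Q ^ 2 + R ^ 2 - S ^ 2 := by rw [hu]; field_simp
  have hv : 0 ≤ Q ^ 2 - u ^ 2 := by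
    have e1 : 0 ≤ 2 * R * (Q - u) := by nlinarith
    have e2 : 0 ≤ 2 * R * (Q + u) := by nlinarith
    have e3 : 0 ≤ Q - u := by
      by_contra! h; nlinarith
    have e4 : 0 ≤ Q + u := by
      by_contra! h; nlinarith
    nlinarith
  have hv2 := Real.sq_sqrt hv
  set v := √(Q ^ 2 - u ^ 2) with hvdef
  have hlR : l * R ∈ Icc 0 R := ⟨mul_nonneg hl.1 hR.le, by nlinarith [hl.2]⟩
  have key := hX.comparison p x q c₁ c hc₁ hc Q ⟨hQ, le_rfl⟩ (l * R) hlR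
    !₂[0, 0] !₂[u, v] !₂[R, 0] !₂[u, v] !₂[l * R, 0]
    (by rw [dist_sq_plane, ← hQdef]
        rw [show (0 - u) ^ 2 + (0 - v) ^ 2 = Q ^ 2 by linarith, Real.sqrt_sq hQ])
    (by rw [dist_sq_plane, ← hRdef]
        rw [show (0 - R) ^ 2 + (0 - 0) ^ 2 = R ^ 2 by ring, Real.sqrt_sq hR.le])
    (by rw [dist_sq_plane, ← hSdef]
        rw [show (u - R) ^ 2 + (v - 0) ^ 2 = S ^ 2 by nlinarith, Real.sqrt_sq hS])
    (by rw [dist_sq_plane]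
        rw [show (0 - u) ^ 2 + (0 - v) ^ 2 = Q ^ 2 by linarith, Real.sqrt_sq hQ])
    (by rw [dist_self, ← hQdef, sub_self])
    (by rw [dist_sq_plane]
        rw [show (0 - l * R) ^ 2 + (0 - 0) ^ 2 = (l * R) ^ 2 by ring, Real.sqrt_sq hlR.1])
    (by rw [dist_sq_plane, ← hRdef]
        rw [show (l * R - R) ^ 2 + (0 - 0) ^ 2 = (R - l * R) ^ 2 by ring,
          Real.sqrt_sq (by linarith [hlR.2])])
  rw [hc₁.2.1, dist_sq_plane] at key
  have h0 : 0 ≤ (u - l * R) ^ 2 + (v - 0) ^ 2 := by positivity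
  have k2 : dist x (c (l * R)) ^ 2 ≤ (u - l * R) ^ 2 + (v - 0) ^ 2 := by
    rw [← Real.sq_sqrt h0]
    exact pow_le_pow_left₀ dist_nonneg key 2
  rw [dist_comm x p, ← hQdef]
  have : (u - l * R) ^ 2 + (v - 0) ^ 2 = Q ^ 2 - l * (2 * R * u) + l ^ 2 * R ^ 2 := by
    rw [sub_zero, hv2]; ring
  rw [this, huR] at k2
  linarith

/-- The inequality of Bruhat and Tits, at an arbitrary point of a segment. -/
theorem IsCAT0.cn (hX : IsCAT0 X) {p q z : X} (x : X) {l : ℝ} (hl : l ∈ Icc (0 : ℝ) 1)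
    (hz : DivPoint l p q z) :
    dist x z ^ 2 ≤ (1 - l) * dist x p ^ 2 + l * dist x q ^ 2 - l * (1 - l) * dist p q ^ 2 := by
  obtain ⟨c, hc⟩ := hX.geodesic p q
  -- Applied to z itself, the right-hand side is zero, so z is the point of the chosen segment.
  have h1 := hX.cn_minimizing z hc hl
  rw [dist_comm z p, hz.1, hz.2] at h1
  have h2 : dist z (c (l * dist p q)) = 0 := by
    have : dist z (c (l * dist p q)) ^ 2 ≤ 0 := by linarith
    exact pow_eq_zero_iff two_ne_zero |>.1 (le_antisymm this (sq_nonneg _))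
  rw [dist_eq_zero.1 h2]
  exact hX.cn_minimizing x hc hl

/-- The four point inequality of Reshetnyak. -/
theorem IsCAT0.four_points (hX : IsCAT0 X) (p q r s : X) :
    dist p r ^ 2 + dist q s ^ 2 ≤
      dist p q ^ 2 + dist r s ^ 2 + 2 * dist q r * dist p s := by
  -- Divide the diagonal pr in the ratio A : B and add the inequalities seen from q and s. The best
  -- weights are A = |ps|, B = |qr|; as these may vanish, both are increased by e, and then e → 0.
  have key : ∀ A B : ℝ, 0 < A → 0 < B → dist p r ^ 2 + dist q s ^ 2 ≤
      dist p q ^ 2 + dist r s ^ 2 + A / B * dist q r ^ 2 + B / A * dist p s ^ 2 := by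
    intro A B hA hB
    have hAB : 0 < A + B := by linarith
    have hl : A / (A + B) ∈ Icc (0 : ℝ) 1 := ⟨by positivity, by rw [div_le_one hAB]; linarith⟩
    obtain ⟨m, hm⟩ := hX.exists_divPoint p r hl
    have h1 := hX.cn q hl hm
    have h2 := hX.cn s hl hm
    have h3 : dist q s ≤ dist q m + dist s m := dist_triangle_right q s m
    have h4 : dist q s ^ 2 ≤ (A + B) / B * dist q m ^ 2 + (A + B) / A * dist s m ^ 2 := by
      have h5 : dist q s ^ 2 ≤ (dist q m + dist s m) ^ 2 := pow_le_pow_left₀ dist_nonneg h3 2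
      have h6 : (A + B) / B * dist q m ^ 2 + (A + B) / A * dist s m ^ 2
          - (dist q m + dist s m) ^ 2 = (A * dist q m - B * dist s m) ^ 2 / (A * B) := by
        field_simp; ring
      have h7 : 0 ≤ (A * dist q m - B * dist s m) ^ 2 / (A * B) := by positivity
      linarith
    have h8 := mul_le_mul_of_nonneg_left h1 (show 0 ≤ (A + B) / B by positivity)
    have h9 := mul_le_mul_of_nonneg_left h2 (show 0 ≤ (A + B) / A by positivity)
    have h10 : (A + B) / B * ((1 - A / (A + B)) * dist q p ^ 2 + A / (A + B) * dist q r ^ 2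
        - A / (A + B) * (1 - A / (A + B)) * dist p r ^ 2) +
        (A + B) / A * ((1 - A / (A + B)) * dist s p ^ 2 + A / (A + B) * dist s r ^ 2
        - A / (A + B) * (1 - A / (A + B)) * dist p r ^ 2) =
        dist q p ^ 2 + dist s r ^ 2 + A / B * dist q r ^ 2 + B / A * dist s p ^ 2
          - dist p r ^ 2 := by
      field_simp; ring
    rw [dist_comm p q, dist_comm r s, dist_comm p s]
    linarith
  have lim : Tendsto (fun e : ℝ => dist p q ^ 2 + dist r s ^ 2 +
      (dist p s + e) * dist q r + (dist q r + e) * dist p s) (𝓝[>] 0)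
      (𝓝 (dist p q ^ 2 + dist r s ^ 2 + 2 * dist q r * dist p s)) := by
    have : Continuous (fun e : ℝ => dist p q ^ 2 + dist r s ^ 2 +
      (dist p s + e) * dist q r + (dist q r + e) * dist p s) := by fun_prop
    have h := (this.tendsto 0).mono_left (nhdsWithin_le_nhds (s := Ioi 0))
    convert h using 2
    ring
  refine ge_of_tendsto lim ?_
  filter_upwards [self_mem_nhdsWithin] with e he
  have he : 0 < e := he
  have hu : 0 ≤ dist p s := dist_nonneg
  have hv : 0 ≤ dist q r := dist_nonneg
  refine (key (dist p s + e) (dist q r + e) (by positivity) (by positivity)).trans ?_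
  have e1 : (dist p s + e) / (dist q r + e) * dist q r ^ 2 ≤ (dist p s + e) * dist q r := by
    rw [div_mul_eq_mul_div, div_le_iff₀ (by positivity)]
    nlinarith [mul_nonneg (add_nonneg hu he.le) (mul_nonneg hv he.le)]
  have e2 : (dist q r + e) / (dist p s + e) * dist p s ^ 2 ≤ (dist q r + e) * dist p s := by
    rw [div_mul_eq_mul_div, div_le_iff₀ (by positivity)]
    nlinarith [mul_nonneg (add_nonneg hv he.le) (mul_nonneg hu he.le)]
  linarith

/-- Two uses of `IsCAT0.cn`, from x on the side pr and from r on the side pq; the terms in |pq| and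
|pr| cancel. -/
theorem IsCAT0.divPoint_dist_le_of_left (hX : IsCAT0 X) {p q r x y : X} {l : ℝ}
    (hl : l ∈ Icc (0 : ℝ) 1) (hx : DivPoint l p q x) (hy : DivPoint l p r y) :
    dist x y ≤ l * dist q r := by
  have h1 := hX.cn x hl hy
  have h2 := hX.cn r hl hx
  rw [dist_comm x p, hx.1, dist_comm x r] at h1
  rw [dist_comm r p, dist_comm r q] at h2
  have h3 := mul_le_mul_of_nonneg_left h2 hl.1
  refine abs_le_of_sq_le_sq' (a := dist x y) ?_ (mul_nonneg hl.1 dist_nonneg) |>.2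
  nlinarith

/-- Convexity of the distance function. -/
theorem IsCAT0.divPoint_dist_le (hX : IsCAT0 X) {p q p' q' x y : X} {l : ℝ}
    (hl : l ∈ Icc (0 : ℝ) 1) (hx : DivPoint l p q x) (hy : DivPoint l p' q' y) :
    dist x y ≤ (1 - l) * dist p p' + l * dist q q' := by
  obtain ⟨z, hz⟩ := hX.exists_divPoint p q' hl
  have h1 := hX.divPoint_dist_le_of_left hl hx hz
  have h2 := hX.divPoint_dist_le_of_left (l := 1 - l) ⟨by linarith [hl.2], by linarith [hl.1]⟩
    hz.symm hy.symm
  linarith [dist_triangle x z y]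

theorem IsCAT0.divPoint_unique (hX : IsCAT0 X) {p q x y : X} {l : ℝ}
    (hl : l ∈ Icc (0 : ℝ) 1) (hx : DivPoint l p q x) (hy : DivPoint l p q y) : x = y := by
  have := hX.divPoint_dist_le hl hx hy
  simp only [dist_self, mul_zero, add_zero] at this
  exact dist_le_zero.1 this

/-- A point at which the triangle inequality is an equality divides the segment. -/
theorem exists_divPoint_of_dist_add {p q z : X} (h : dist p z + dist z q = dist p q) :
    ∃ l ∈ Icc (0 : ℝ) 1, DivPoint l p q z := by
  rcases eq_or_ne p q with rfl | hpq
  · have : p = z := by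
      rw [dist_self, dist_comm z p] at h
      exact dist_le_zero.1 (by linarith [dist_nonneg (x := p) (y := z)])
    exact ⟨0, by simp, this ▸ divPoint_zero p p⟩
  · have hd : 0 < dist p q := dist_pos.2 hpq
    refine ⟨dist p z / dist p q, ⟨by positivity, ?_⟩, ?_, ?_⟩
    · rw [div_le_one hd]; linarith [dist_nonneg (x := z) (y := q)]
    · field_simp
    · field_simp; linarith

theorem DivPoint.dist_add {p q z : X} {l : ℝ} (h : DivPoint l p q z) :
    dist p z + dist z q = dist p q := by
  rw [h.1, h.2]; ring

/-! ### Properness (Hopf–Rinow) -/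

/-- A complete locally compact geodesic space is proper. -/
theorem IsCAT0.properSpace [LocallyCompactSpace X] (hX : IsCAT0 X) : ProperSpace X := by
  have := hX.complete
  have hthick : ∀ (o : X) (r e : ℝ), 0 ≤ r → 0 ≤ e → ∀ y ∈ Metric.closedBall o (r + e),
      ∃ z ∈ Metric.closedBall o r, dist y z ≤ e := by
    intro o r e hr he y hy
    rw [Metric.mem_closedBall, dist_comm] at hy
    by_cases hyr : dist o y ≤ r
    · exact ⟨y, by rwa [Metric.mem_closedBall, dist_comm], by simpa⟩
    · push Not at hyr
      have hpos : 0 < dist o y := by linarith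
      obtain ⟨z, hz⟩ := hX.exists_divPoint o y (l := r / dist o y)
        ⟨by positivity, by rw [div_le_one hpos]; exact hyr.le⟩
      have h1 : dist o z = r := by rw [hz.1]; field_simp
      refine ⟨z, by rw [Metric.mem_closedBall, dist_comm, h1], ?_⟩
      have := hz.dist_add
      rw [dist_comm y z]; linarith
  refine ⟨fun o => ?_⟩
  by_contra! hbad
  obtain ⟨R, hR⟩ := hbad
  -- The ball whose radius is the supremum ρ is totally bounded, being close to smaller compact
  -- balls, hence compact; local compactness then enlarges it beyond ρ.
  let S : Set ℝ := {r | 0 ≤ r ∧ IsCompact (Metric.closedBall o r)}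
  have hSR : ∀ r ∈ S, r ≤ R := by
    intro r hr
    by_contra! h
    exact hR (hr.2.of_isClosed_subset Metric.isClosed_closedBall
      (Metric.closedBall_subset_closedBall h.le))
  have h0 : (0 : ℝ) ∈ S := ⟨le_rfl, by simp⟩
  have hbdd : BddAbove S := ⟨R, hSR⟩
  set ρ := sSup S with hρ
  have hρ0 : 0 ≤ ρ := le_csSup hbdd h0
  have hlt : ∀ r, 0 ≤ r → r < ρ → IsCompact (Metric.closedBall o r) := by
    intro r _ hr'
    obtain ⟨s, hs, hrs⟩ := exists_lt_of_lt_csSup ⟨0, h0⟩ hr'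
    exact hs.2.of_isClosed_subset Metric.isClosed_closedBall
      (Metric.closedBall_subset_closedBall hrs.le)
  have hcomp : IsCompact (Metric.closedBall o ρ) := by
    refine TotallyBounded.isCompact_of_isClosed ?_ Metric.isClosed_closedBall
    rw [Metric.totallyBounded_iff]
    intro e he
    have hr : IsCompact (Metric.closedBall o (max 0 (ρ - e / 2))) := by
      rcases le_total (ρ - e / 2) 0 with h | h
      · rw [max_eq_left h]; simp
      · rw [max_eq_right h]; exact hlt _ h (by linarith)
    obtain ⟨t, ht, htc⟩ := Metric.totallyBounded_iff.1 hr.totallyBounded (e / 2) (by linarith)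
    refine ⟨t, ht, fun y hy => ?_⟩
    obtain ⟨z, hz, hyz⟩ := hthick o (max 0 (ρ - e / 2)) (e / 2) (le_max_left _ _) (by linarith) y
      (Metric.closedBall_subset_closedBall (by linarith [le_max_right 0 (ρ - e / 2)]) hy)
    have := htc hz
    simp only [mem_iUnion, Metric.mem_ball] at this ⊢
    obtain ⟨w, hw, hzw⟩ := this
    exact ⟨w, hw, by linarith [dist_triangle y z w]⟩
  obtain ⟨e, he, hce⟩ := hcomp.exists_isCompact_cthickening
  have : ρ + e ∈ S := by
    refine ⟨by linarith, hce.of_isClosed_subset Metric.isClosed_closedBall fun y hy => ?_⟩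
    obtain ⟨z, hz, hyz⟩ := hthick o ρ e hρ0 he.le y hy
    exact Metric.mem_cthickening_of_dist_le y z e _ hz hyz
  linarith [le_csSup hbdd this]

/-! ### Asymptotic rays and Busemann functions -/

theorem GeodesicRay.dist_eq (r : GeodesicRay X) (s t : ℝ≥0) :
    dist (r.toFun s) (r.toFun t) = |(s : ℝ) - t| := by
  rw [r.isometry.dist_eq, NNReal.dist_eq]

theorem GeodesicLine.dist_eq (c : GeodesicLine X) (s t : ℝ) :
    dist (c.toFun s) (c.toFun t) = |s - t| := by
  rw [c.isometry.dist_eq, Real.dist_eq]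

/-- Rays are asymptotic if and only if they stay at bounded distance. -/
theorem GeodesicRay.endpoint_eq_iff {r r' : GeodesicRay X} :
    r.endpoint = r'.endpoint ↔ ∃ C, ∀ t, dist (r.toFun t) (r'.toFun t) ≤ C := by
  refine Quotient.eq.trans ⟨fun h => ?_, ?_⟩
  · have h' : Metric.hausdorffEDist r.image r'.image ≠ ⊤ := h
    obtain ⟨M, hM⟩ := ENNReal.lt_iff_exists_nnreal_btwn.1 h'.lt_top
    refine ⟨2 * M + dist (r.toFun 0) (r'.toFun 0), fun t => ?_⟩
    obtain ⟨_, ⟨s, rfl⟩, hs⟩ := Metric.exists_edist_lt_of_hausdorffEDist_lt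
      (mem_range_self t : r.toFun t ∈ r.image) hM.1
    have hs' : dist (r.toFun t) (r'.toFun s) < M := by
      rw [edist_nndist] at hs
      exact_mod_cast hs
    have h1 := r.dist_eq 0 t
    have h2 := r'.dist_eq 0 s
    simp only [NNReal.coe_zero, zero_sub, abs_neg, NNReal.abs_eq] at h1 h2
    have h3 := r'.dist_eq s t
    have h4 : |(s : ℝ) - t| ≤ M + dist (r.toFun 0) (r'.toFun 0) := by
      rw [abs_le]
      have e1 := dist_triangle4 (r.toFun 0) (r'.toFun 0) (r'.toFun s) (r.toFun t)
      have e2 := dist_triangle4 (r'.toFun 0) (r.toFun 0) (r.toFun t) (r'.toFun s)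
      rw [dist_comm (r'.toFun s)] at e1
      rw [dist_comm (r'.toFun 0) (r.toFun 0)] at e2
      constructor <;> linarith
    linarith [dist_triangle (r.toFun t) (r'.toFun s) (r'.toFun t)]
  · rintro ⟨C, hC⟩
    have : Metric.hausdorffEDist r.image r'.image ≤ ENNReal.ofReal C := by
      refine Metric.hausdorffEDist_le_of_mem_edist ?_ ?_
      · rintro _ ⟨t, rfl⟩
        refine ⟨_, mem_range_self t, ?_⟩
        rw [edist_dist]
        exact ENNReal.ofReal_le_ofReal (hC t)
      · rintro _ ⟨t, rfl⟩
        refine ⟨_, mem_range_self t, ?_⟩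
        rw [edist_dist, dist_comm]
        exact ENNReal.ofReal_le_ofReal (hC t)
    exact ne_top_of_le_ne_top ENNReal.ofReal_ne_top this

theorem GeodesicRay.divPoint (r : GeodesicRay X) {s t : ℝ≥0} (hst : s ≤ t) (ht : 0 < t) :
    DivPoint ((s : ℝ) / t) (r.toFun 0) (r.toFun t) (r.toFun s) := by
  have ht' : (0 : ℝ) < t := by exact_mod_cast ht
  have hst' : (s : ℝ) ≤ t := by exact_mod_cast hst
  refine ⟨?_, ?_⟩
  · rw [r.dist_eq, r.dist_eq]; simp; field_simp
  · rw [r.dist_eq, r.dist_eq, abs_sub_comm, abs_of_nonneg (by linarith)]; simp; field_simp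

theorem GeodesicLine.divPoint (c : GeodesicLine X) (s u : ℝ) {l : ℝ} (hl : l ∈ Icc (0 : ℝ) 1) :
    DivPoint l (c.toFun s) (c.toFun u) (c.toFun ((1 - l) * s + l * u)) := by
  refine ⟨?_, ?_⟩
  · rw [c.dist_eq, c.dist_eq, show s - ((1 - l) * s + l * u) = l * (s - u) by ring, abs_mul,
      abs_of_nonneg hl.1]
  · rw [c.dist_eq, c.dist_eq, show (1 - l) * s + l * u - u = (1 - l) * (s - u) by ring, abs_mul,
      abs_of_nonneg (by linarith [hl.2])]

theorem tendsto_nnreal_inv : Tendsto (fun t : ℝ≥0 => (t : ℝ)⁻¹) atTop (𝓝 0) :=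
  tendsto_inv_atTop_zero.comp (NNReal.tendsto_coe_atTop.2 tendsto_id)

/-- The distance between asymptotic rays is largest at their origins. -/
theorem IsCAT0.dist_ray_le (hX : IsCAT0 X) {r r' : GeodesicRay X}
    (h : r.endpoint = r'.endpoint) (t : ℝ≥0) :
    dist (r.toFun t) (r'.toFun t) ≤ dist (r.toFun 0) (r'.toFun 0) := by
  obtain ⟨C, hC⟩ := GeodesicRay.endpoint_eq_iff.1 h
  have lim : Tendsto (fun T : ℝ≥0 => dist (r.toFun 0) (r'.toFun 0) + (t : ℝ) * C * (T : ℝ)⁻¹)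
      atTop (𝓝 (dist (r.toFun 0) (r'.toFun 0) + (t : ℝ) * C * 0)) :=
    tendsto_const_nhds.add (tendsto_const_nhds.mul tendsto_nnreal_inv)
  rw [mul_zero, add_zero] at lim
  refine ge_of_tendsto lim ?_
  filter_upwards [eventually_gt_atTop t] with T hT
  have hT0 : 0 < T := pos_of_gt hT
  have hT0' : (0 : ℝ) < T := by exact_mod_cast hT0
  have hT' : (t : ℝ) ≤ T := by exact_mod_cast hT.le
  have hl : (t : ℝ) / T ∈ Icc (0 : ℝ) 1 := ⟨by positivity, by rwa [div_le_one hT0']⟩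
  have h1 := hX.divPoint_dist_le hl (r.divPoint hT.le hT0) (r'.divPoint hT.le hT0)
  have h2 := mul_le_mul_of_nonneg_left (hC T) hl.1
  have h3 : (t : ℝ) / T * C = t * C * (T : ℝ)⁻¹ := by ring
  have h4 : 0 ≤ (t : ℝ) / T * dist (r.toFun 0) (r'.toFun 0) := mul_nonneg hl.1 dist_nonneg
  linarith

theorem busemann_le (r : GeodesicRay X) (x : X) (t : ℝ≥0) :
    busemann r x ≤ dist x (r.toFun t) - t := by
  refine le_of_tendsto (tendsto_busemann r x) ?_
  filter_upwards [eventually_ge_atTop t] with s hs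
  have h1 := dist_triangle x (r.toFun t) (r.toFun s)
  have hs' : (t : ℝ) ≤ s := by exact_mod_cast hs
  rw [r.dist_eq t s, abs_sub_comm, abs_of_nonneg (by linarith)] at h1
  linarith

theorem busemann_le_add_dist (r : GeodesicRay X) (x y : X) :
    busemann r x ≤ busemann r y + dist x y := by
  refine le_of_tendsto_of_tendsto' (tendsto_busemann r x)
    ((tendsto_busemann r y).add_const (dist x y)) fun t => ?_
  linarith [dist_triangle x y (r.toFun t)]

theorem continuous_busemann (r : GeodesicRay X) : Continuous (busemann r) := by
  refine (LipschitzWith.of_le_add fun x y => ?_ : LipschitzWith 1 (busemann r)).continuous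
  exact busemann_le_add_dist r x y

/-- The term differs from |x r(t)| - t by (|x r(t)| - t)²/(2t), which tends to 0. This form fits
inequalities between squared distances. -/
theorem tendsto_busemann_sq (r : GeodesicRay X) (x : X) :
    Tendsto (fun t : ℝ≥0 => (dist x (r.toFun t) ^ 2 - (t : ℝ) ^ 2) * (2 * (t : ℝ))⁻¹) atTop
      (𝓝 (busemann r x)) := by
  have h := tendsto_busemann r x
  have h2 := h.add (((h.pow 2).mul_const (2 : ℝ)⁻¹).mul tendsto_nnreal_inv)
  rw [mul_zero, add_zero] at h2
  refine h2.congr' ?_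
  filter_upwards [eventually_gt_atTop 0] with t ht
  have : (0 : ℝ) < t := by exact_mod_cast ht
  field_simp
  ring

/-- Busemann functions of asymptotic rays differ by a constant. -/
theorem IsCAT0.busemann_sub_eq (hX : IsCAT0 X) {r r' : GeodesicRay X}
    (h : r.endpoint = r'.endpoint) (x y : X) :
    busemann r x - busemann r' x = busemann r y - busemann r' y := by
  obtain ⟨C, hC⟩ := GeodesicRay.endpoint_eq_iff.1 h
  have key : ∀ x y : X,
      busemann r x - busemann r' x - (busemann r y - busemann r' y) ≤ 0 := by
    intro x y
    have h1 := ((tendsto_busemann_sq r x).sub (tendsto_busemann_sq r' x)).sub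
      ((tendsto_busemann_sq r y).sub (tendsto_busemann_sq r' y))
    have h2 : Tendsto (fun t : ℝ≥0 => C * dist x y * (t : ℝ)⁻¹) atTop (𝓝 (C * dist x y * 0)) :=
      tendsto_const_nhds.mul tendsto_nnreal_inv
    rw [mul_zero] at h2
    refine le_of_tendsto_of_tendsto h1 h2 ?_
    filter_upwards [eventually_gt_atTop 0] with t ht
    have ht' : (0 : ℝ) < t := by exact_mod_cast ht
    -- The error 2 |r(t) r'(t)| |xy| is bounded in t and disappears after division by 2t.
    have h3 := hX.four_points x (r'.toFun t) (r.toFun t) y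
    have h4 := hC t
    rw [dist_comm (r'.toFun t) (r.toFun t), dist_comm (r'.toFun t) y,
      dist_comm (r.toFun t) y] at h3
    have h5 : 2 * dist (r.toFun t) (r'.toFun t) * dist x y ≤ 2 * C * dist x y :=
      mul_le_mul_of_nonneg_right (by linarith) dist_nonneg
    have h6 : C * dist x y * (t : ℝ)⁻¹ = (2 * C * dist x y) * (2 * (t : ℝ))⁻¹ := by
      field_simp
    rw [h6, ← sub_mul, ← sub_mul, ← sub_mul]
    refine mul_le_mul_of_nonneg_right ?_ (by positivity)
    linarith
  linarith [key x y, key y x]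

/-- A quadratic lower bound for the Busemann function of a ray. -/
theorem IsCAT0.le_busemann (hX : IsCAT0 X) (r : GeodesicRay X) (x : X) (t : ℝ≥0) :
    dist x (r.toFun t) ^ 2 ≤ (t : ℝ) ^ 2 + 2 * t * busemann r x + dist x (r.toFun 0) ^ 2 := by
  have h1 := (tendsto_const_nhds (x := (t : ℝ) ^ 2 + dist x (r.toFun 0) ^ 2)).add
    ((tendsto_busemann_sq r x).const_mul (2 * (t : ℝ)))
  refine (ge_of_tendsto h1 ?_).trans_eq (by ring)
  filter_upwards [eventually_gt_atTop t] with T hT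
  have hT0 : 0 < T := pos_of_gt hT
  have hT0' : (0 : ℝ) < T := by exact_mod_cast hT0
  have hT' : (t : ℝ) ≤ T := by exact_mod_cast hT.le
  have hl : (t : ℝ) / T ∈ Icc (0 : ℝ) 1 := ⟨by positivity, by rwa [div_le_one hT0']⟩
  -- View r(t) as a point of the segment from r(0) to r(T) and let T → ∞.
  have h2 := hX.cn x hl (r.divPoint hT.le hT0)
  have h3 : dist (r.toFun 0) (r.toFun T) = T := by rw [r.dist_eq]; simp
  rw [h3] at h2
  have h4 : (t : ℝ) / T * (1 - t / T) * T ^ 2 = t * T - t ^ 2 := by field_simp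
  have h5 : 2 * (t : ℝ) * ((dist x (r.toFun T) ^ 2 - (T : ℝ) ^ 2) * (2 * (T : ℝ))⁻¹) =
      t / T * dist x (r.toFun T) ^ 2 - t * T := by field_simp
  have h6 : 0 ≤ (t : ℝ) / T * dist x (r.toFun 0) ^ 2 := mul_nonneg hl.1 (sq_nonneg _)
  rw [h5]
  linarith

/-! ### Busemann sums and the displacement formula -/

/-- The geodesic `c` traversed backwards. -/
def GeodesicLine.reverse (c : GeodesicLine X) : GeodesicLine X where
  toFun t := c.toFun (-t)
  isometry := c.isometry.comp (IsometryEquiv.neg ℝ).isometry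

theorem GeodesicLine.reverse_posRay (c : GeodesicLine X) : c.reverse.posRay = c.negRay := rfl

/-- The geodesic `c`, parametrized so that it passes through `c u` at time `0`. -/
def GeodesicLine.shift (c : GeodesicLine X) (u : ℝ) : GeodesicLine X where
  toFun t := c.toFun (t + u)
  isometry := c.isometry.comp (IsometryEquiv.addRight u).isometry

theorem GeodesicLine.shift_posEnd (c : GeodesicLine X) (u : ℝ) :
    (c.shift u).posEnd = c.posEnd :=
  GeodesicRay.endpoint_eq_iff.2 ⟨|u|, fun t => by
    simp [GeodesicLine.posRay, GeodesicLine.shift, c.dist_eq]⟩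

theorem GeodesicLine.shift_negEnd (c : GeodesicLine X) (u : ℝ) :
    (c.shift u).negEnd = c.negEnd :=
  GeodesicRay.endpoint_eq_iff.2 ⟨|u|, fun t => by
    simp [GeodesicLine.negRay, GeodesicLine.shift, c.dist_eq]⟩

theorem GeodesicLine.busemann_posRay (c : GeodesicLine X) (s : ℝ) :
    busemann c.posRay (c.toFun s) = -s := by
  refine tendsto_nhds_unique (tendsto_busemann c.posRay (c.toFun s)) ?_
  refine tendsto_const_nhds.congr' ?_
  filter_upwards [eventually_ge_atTop s.toNNReal] with t ht
  have : s ≤ t := Real.toNNReal_le_iff_le_coe.1 ht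
  simp only [GeodesicLine.posRay]
  rw [c.dist_eq, abs_sub_comm, abs_of_nonneg (by linarith)]
  ring

theorem GeodesicLine.busemann_negRay (c : GeodesicLine X) (s : ℝ) :
    busemann c.negRay (c.toFun s) = s := by
  have := c.reverse.busemann_posRay (-s)
  rw [c.reverse_posRay] at this
  simpa [GeodesicLine.reverse] using this

/-- The sum of the two Busemann functions of a complete geodesic, normalized along it. -/
noncomputable def GeodesicLine.busemannSum (c : GeodesicLine X) (x : X) : ℝ :=
  busemann c.posRay x + busemann c.negRay x

theorem GeodesicLine.busemannSum_of_mem (c : GeodesicLine X) {x : X} (hx : x ∈ c.image) :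
    c.busemannSum x = 0 := by
  obtain ⟨s, rfl⟩ := hx
  rw [busemannSum, c.busemann_posRay, c.busemann_negRay]
  ring

theorem GeodesicLine.busemannSum_nonneg (c : GeodesicLine X) (x : X) : 0 ≤ c.busemannSum x := by
  refine ge_of_tendsto' ((tendsto_busemann c.posRay x).add (tendsto_busemann c.negRay x))
    fun t => ?_
  have h1 := dist_triangle_left (c.toFun t) (c.toFun (-t)) x
  rw [c.dist_eq, abs_of_nonneg (by linarith [t.2])] at h1
  simp only [posRay, negRay]
  linarith

theorem GeodesicLine.continuous_busemannSum (c : GeodesicLine X) : Continuous c.busemannSum :=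
  (continuous_busemann _).add (continuous_busemann _)

/-- The two sums differ by a constant. Each is nonnegative and vanishes on its own geodesic, so the
constant has both signs. -/
theorem IsCAT0.busemannSum_eq (hX : IsCAT0 X) {c c' : GeodesicLine X}
    (h1 : c.posEnd = c'.posEnd) (h2 : c.negEnd = c'.negEnd) (x : X) :
    c.busemannSum x = c'.busemannSum x := by
  have key : ∀ y, c.busemannSum x - c'.busemannSum x = c.busemannSum y - c'.busemannSum y := by
    intro y
    simp only [GeodesicLine.busemannSum]
    linarith [hX.busemann_sub_eq h1 x y, hX.busemann_sub_eq h2 x y]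
  have e1 := key (c.toFun 0)
  have e2 := key (c'.toFun 0)
  rw [c.busemannSum_of_mem ⟨0, rfl⟩] at e1
  rw [c'.busemannSum_of_mem ⟨0, rfl⟩] at e2
  linarith [c.busemannSum_nonneg (c'.toFun 0), c'.busemannSum_nonneg (c.toFun 0)]

/-- Along `c` the Busemann function is affine of slope ∓1, hence takes every value. -/
theorem IsCAT0.transfer_spec (hX : IsCAT0 X) {r : GeodesicRay X} {c : GeodesicLine X}
    (h : r.endpoint = c.posEnd ∨ r.endpoint = c.negEnd) (m : X) :
    transfer r c m ∈ c.image ∧ busemann r (transfer r c m) = busemann r m := by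
  have hex : ∃ m' ∈ c.image, busemann r m' = busemann r m := by
    rcases h with h | h
    · refine ⟨_, ⟨busemann r (c.toFun 0) - busemann r m, rfl⟩, ?_⟩
      have := hX.busemann_sub_eq (r' := c.posRay) h
        (c.toFun (busemann r (c.toFun 0) - busemann r m)) (c.toFun 0)
      rw [c.busemann_posRay, c.busemann_posRay] at this
      linarith
    · refine ⟨_, ⟨busemann r m - busemann r (c.toFun 0), rfl⟩, ?_⟩
      have := hX.busemann_sub_eq (r' := c.negRay) h
        (c.toFun (busemann r m - busemann r (c.toFun 0))) (c.toFun 0)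
      rw [c.busemann_negRay, c.busemann_negRay] at this
      linarith
  rw [transfer, dif_pos hex]
  exact hex.choose_spec

/-- The displacement of the scissors translation in terms of Busemann functions. -/
theorem IsCAT0.displacementAt_eq (hX : IsCAT0 X) {a b c d : GeodesicLine X} {x : X}
    (h : IsScissors a b c d x) {m : X} (hm : m ∈ a.image) :
    displacementAt a b c d m = a.busemannSum x + d.busemannSum x := by
  have hx : x ∈ b.image ∩ c.image := by rw [h.inter]; rfl
  obtain ⟨i1, e1⟩ := hX.transfer_spec (r := a.posRay) (c := c) (Or.inl h.a_pos_c) m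
  set m1 := transfer a.posRay c m
  obtain ⟨i2, e2⟩ := hX.transfer_spec (r := c.negRay) (c := d) (Or.inr h.c_neg_d) m1
  set m2 := transfer c.negRay d m1
  obtain ⟨i3, e3⟩ := hX.transfer_spec (r := d.posRay) (c := b) (Or.inl h.b_pos_d.symm) m2
  set m3 := transfer d.posRay b m2
  obtain ⟨i4, e4⟩ := hX.transfer_spec (r := b.negRay) (c := a) (Or.inr h.a_neg_b.symm) m3
  -- All normalizing constants are evaluated at x, which leaves S_a + S_d - S_b - S_c there.
  have k1 := hX.busemann_sub_eq h.a_pos_c m1 x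
  have k2 := hX.busemann_sub_eq h.c_neg_d m2 x
  have k3 := hX.busemann_sub_eq h.b_pos_d m3 x
  have k4 := hX.busemann_sub_eq h.a_neg_b (transfer b.negRay a m3) x
  have z0 := a.busemannSum_of_mem hm
  have z1 := c.busemannSum_of_mem i1
  have z2 := d.busemannSum_of_mem i2
  have z3 := b.busemannSum_of_mem i3
  have z4 := b.busemannSum_of_mem hx.1
  have z5 := c.busemannSum_of_mem hx.2
  have e : displacementAt a b c d m =
    busemann a.negRay (transfer b.negRay a m3) - busemann a.negRay m := rfl
  rw [e]
  simp only [GeodesicLine.busemannSum] at *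
  linarith

/-! ### The flat strip theorem -/

/-- The distance between parallel geodesics is invariant under simultaneous translation. -/
theorem IsCAT0.dist_translate_eq (hX : IsCAT0 X) {c c' : GeodesicLine X} {C : ℝ}
    (h : ∀ t, dist (c.toFun t) (c'.toFun t) ≤ C) (s t u : ℝ) :
    dist (c.toFun (s + u)) (c'.toFun (t + u)) = dist (c.toFun s) (c'.toFun t) := by
  have key : ∀ s t u : ℝ,
      dist (c.toFun (s + u)) (c'.toFun (t + u)) ≤ dist (c.toFun s) (c'.toFun t) := by
    intro s t u
    have lim : Tendsto (fun l : ℝ => dist (c.toFun s) (c'.toFun t) + l * (C + |s - t|)) (𝓝[>] 0)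
        (𝓝 (dist (c.toFun s) (c'.toFun t) + 0 * (C + |s - t|))) := by
      have : Continuous fun l : ℝ => dist (c.toFun s) (c'.toFun t) + l * (C + |s - t|) := by
        fun_prop
      exact (this.tendsto 0).mono_left nhdsWithin_le_nhds
    rw [zero_mul, add_zero] at lim
    refine ge_of_tendsto lim ?_
    filter_upwards [Ioc_mem_nhdsGT (zero_lt_one' ℝ)] with l hl
    have hl' : l ∈ Icc (0 : ℝ) 1 := ⟨hl.1.le, hl.2⟩
    -- The parameter s + u is at fraction l of the way from s to s + u / l, where the distance is at
    -- most C + |s - t|; convexity and l → 0 finish.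
    have hl0 : l ≠ 0 := hl.1.ne'
    have h1 := c.divPoint s (s + u / l) hl'
    have h2 := c'.divPoint t (t + u / l) hl'
    rw [show (1 - l) * s + l * (s + u / l) = s + u by field_simp; ring] at h1
    rw [show (1 - l) * t + l * (t + u / l) = t + u by field_simp; ring] at h2
    have h3 := hX.divPoint_dist_le hl' h1 h2
    have h4 : dist (c.toFun (s + u / l)) (c'.toFun (t + u / l)) ≤ C + |s - t| := by
      have e := dist_triangle (c.toFun (s + u / l)) (c'.toFun (s + u / l)) (c'.toFun (t + u / l))
      rw [c'.dist_eq, add_sub_add_right_eq_sub] at e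
      linarith [h (s + u / l)]
    have h5 := mul_le_mul_of_nonneg_left h4 hl'.1
    have h6 : 0 ≤ l * dist (c.toFun s) (c'.toFun t) := mul_nonneg hl'.1 dist_nonneg
    linarith
  refine le_antisymm (key s t u) ?_
  have := key (s + u) (t + u) (-u)
  simpa using this

/-- Parallel geodesics span a Euclidean quadrilateral at the feet of their common
perpendicular. -/
theorem IsCAT0.dist_sq_parallel (hX : IsCAT0 X) {c e : GeodesicLine X}
    (hinv : ∀ s t u, dist (c.toFun (s + u)) (e.toFun (t + u)) = dist (c.toFun s) (e.toFun t))
    (hmin : ∀ s, dist (c.toFun 0) (e.toFun 0) ≤ dist (c.toFun 0) (e.toFun s)) (s t : ℝ) :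
    dist (c.toFun s) (e.toFun t) ^ 2 = dist (c.toFun 0) (e.toFun 0) ^ 2 + (s - t) ^ 2 := by
  set w := dist (c.toFun 0) (e.toFun 0) with hw
  clear_value w
  have hG : ∀ s t, dist (c.toFun s) (e.toFun t) = dist (c.toFun 0) (e.toFun (t - s)) := by
    intro s t
    have := hinv 0 (t - s) s
    rwa [zero_add, sub_add_cancel] at this
  -- The defect k in Pythagoras' theorem is midpoint affine: one inequality is `IsCAT0.cn`, the
  -- other `IsCAT0.four_points`. Minimality gives k(s) ≥ -s², which k(s) = 2k(s/2) improves to k ≥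
  -- 0; then k(s) + k(-s) = 0 forces k = 0.
  obtain ⟨k, hk⟩ : ∃ k : ℝ → ℝ, ∀ s, dist (c.toFun 0) (e.toFun s) ^ 2 = w ^ 2 + k s + s ^ 2 :=
    ⟨fun s => dist (c.toFun 0) (e.toFun s) ^ 2 - w ^ 2 - s ^ 2, fun s => by ring⟩
  have haff : ∀ s u, k (s + u) + k (s - u) = 2 * k s := by
    intro s u
    have h1 := hX.cn (c.toFun 0) (l := 1 / 2) (by norm_num)
      (e.divPoint (s + u) (s - u) (l := 1 / 2) (by norm_num))
    rw [show (1 - 1 / 2 : ℝ) * (s + u) + 1 / 2 * (s - u) = s by ring, hk, hk, hk, e.dist_eq,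
      sq_abs] at h1
    have h2 := hX.four_points (c.toFun 0) (c.toFun u) (e.toFun (s + u)) (e.toFun s)
    rw [hG u s, hG u (s + u), hk, hk, c.dist_eq, e.dist_eq, sq_abs, sq_abs, add_sub_cancel_right,
      mul_assoc, ← sq, hk] at h2
    linarith
  have hk0 : k 0 = 0 := by
    have := hk 0
    rw [← hw] at this
    linarith
  have hlow : ∀ (n : ℕ) (s : ℝ), -(s ^ 2 * (1 / 2) ^ n) ≤ k s := by
    intro n
    induction n with
    | zero =>
      intro s
      have h1 := pow_le_pow_left₀ (hw ▸ dist_nonneg) (hmin s) 2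
      rw [hk] at h1
      simp only [pow_zero, mul_one]
      linarith
    | succ n ih =>
      intro s
      have h1 := ih (s / 2)
      have h2 := haff (s / 2) (s / 2)
      rw [add_halves, sub_self, hk0] at h2
      rw [pow_succ (1 / 2 : ℝ) n]
      linarith
  have hnn : ∀ s, 0 ≤ k s := by
    intro s
    have lim : Tendsto (fun n : ℕ => -(s ^ 2 * (1 / 2 : ℝ) ^ n)) atTop (𝓝 (-(s ^ 2 * 0))) :=
      ((tendsto_pow_atTop_nhds_zero_of_lt_one (by norm_num) (by norm_num)).const_mul _).neg
    rw [mul_zero, neg_zero] at lim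
    exact le_of_tendsto' lim fun n => hlow n s
  have hkz : ∀ s, k s = 0 := by
    intro s
    have h1 := haff 0 s
    rw [zero_add, zero_sub, hk0] at h1
    linarith [hnn s, hnn (-s)]
  rw [hG, hk, hkz]
  ring

/-- The flat strip theorem. -/
theorem IsCAT0.boundsFlatStrip (hX : IsCAT0 X) {c c' : GeodesicLine X} {C : ℝ}
    (h : ∀ t, dist (c.toFun t) (c'.toFun t) ≤ C) (h0 : c.toFun 0 ∉ c'.image) :
    c.BoundsFlatStrip := by
  have hcont : Continuous fun s => dist (c.toFun 0) (c'.toFun s) :=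
    continuous_const.dist c'.isometry.continuous
  have hcoer : Tendsto (fun s => dist (c.toFun 0) (c'.toFun s)) (cocompact ℝ) atTop := by
    refine tendsto_atTop_mono (f := fun s : ℝ => ‖s‖ + -dist (c.toFun 0) (c'.toFun 0)) ?_
      (tendsto_atTop_add_const_right _ _ tendsto_norm_cocompact_atTop)
    intro s
    have := dist_triangle_left (c'.toFun 0) (c'.toFun s) (c.toFun 0)
    rw [c'.dist_eq, zero_sub, abs_neg] at this
    rw [Real.norm_eq_abs]
    linarith
  -- The foot of the perpendicular from c(0) becomes the new origin of c'.
  obtain ⟨s₀, hs₀⟩ := hcont.exists_forall_le hcoer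
  set e := c'.shift s₀ with he
  have hinv : ∀ s t u, dist (c.toFun (s + u)) (e.toFun (t + u)) =
      dist (c.toFun s) (e.toFun t) := by
    intro s t u
    have := hX.dist_translate_eq h s (t + s₀) u
    rwa [add_right_comm] at this
  have hsq := hX.dist_sq_parallel hinv fun s => by
    have := hs₀ (s + s₀)
    simpa [he, GeodesicLine.shift] using this
  set w := dist (c.toFun 0) (e.toFun 0)
  have hw : 0 < w := by
    refine dist_pos.2 fun heq => h0 ?_
    rw [heq]
    exact ⟨_, rfl⟩
  have hwt : ∀ t, dist (c.toFun t) (e.toFun t) = w := by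
    intro t
    have := hinv 0 0 t
    rwa [zero_add] at this
  have hdiv : ∀ p : EuclideanSpace ℝ (Fin 2), ∃ z, p 1 ∈ Icc 0 w →
      DivPoint (p 1 / w) (c.toFun (p 0)) (e.toFun (p 0)) z := by
    intro p
    by_cases hp : p 1 ∈ Icc 0 w
    · obtain ⟨z, hz⟩ := hX.exists_divPoint (c.toFun (p 0)) (e.toFun (p 0)) (l := p 1 / w)
        ⟨div_nonneg hp.1 hw.le, (div_le_one hw).2 hp.2⟩
      exact ⟨z, fun _ => hz⟩
    · exact ⟨c.toFun 0, fun h => absurd h hp⟩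
  choose F hF using hdiv
  have hcF : ∀ p, p 1 ∈ Icc 0 w → dist (F p) (c.toFun (p 0)) = p 1 := by
    intro p hp
    have := (hF p hp).1
    rw [hwt, dist_comm] at this
    rw [this]
    field_simp
  have hl : ∀ y ∈ Icc 0 w, y / w ∈ Icc (0 : ℝ) 1 := fun y hy =>
    ⟨div_nonneg hy.1 hw.le, (div_le_one hw).2 hy.2⟩
  have hc_le : ∀ p, p 1 ∈ Icc 0 w → ∀ t,
      dist (F p) (c.toFun t) ^ 2 ≤ p 1 ^ 2 + (p 0 - t) ^ 2 := by
    intro p hp t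
    have h1 := hX.cn (c.toFun t) (hl _ hp) (hF p hp)
    rw [hsq, c.dist_eq, sq_abs, hwt, dist_comm] at h1
    refine h1.trans_eq ?_
    field_simp
    ring
  have he_le : ∀ p, p 1 ∈ Icc 0 w → ∀ t,
      dist (F p) (e.toFun t) ^ 2 ≤ (w - p 1) ^ 2 + (p 0 - t) ^ 2 := by
    intro p hp t
    have h1 := hX.cn (e.toFun t) (hl _ hp) (hF p hp)
    rw [dist_comm _ (c.toFun _), hsq, e.dist_eq, sq_abs, hwt, dist_comm] at h1
    refine h1.trans_eq ?_
    field_simp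
    ring
  have hc_ge : ∀ p, p 1 ∈ Icc 0 w → ∀ t,
      p 1 ^ 2 + (p 0 - t) ^ 2 ≤ dist (F p) (c.toFun t) ^ 2 := by
    intro p hp t
    -- Reflect t in p 0: the midpoint c(p 0) has known distance, so the upper bound at the mirror
    -- point is a lower bound at t.
    have h1 := hX.cn (F p) (l := 1 / 2) (by norm_num)
      (c.divPoint t (2 * p 0 - t) (l := 1 / 2) (by norm_num))
    rw [show (1 - 1 / 2 : ℝ) * t + 1 / 2 * (2 * p 0 - t) = p 0 by ring, hcF p hp, c.dist_eq,
      sq_abs] at h1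
    have h2 := hc_le p hp (2 * p 0 - t)
    linarith
  refine ⟨w, hw, F, fun p q hp hq => ?_, fun t => ?_⟩
  · rw [EuclideanSpace.dist_eq, Fin.sum_univ_two, Real.dist_eq, Real.dist_eq, sq_abs, sq_abs]
    refine (Real.sqrt_eq_iff_mul_self_eq (by positivity) dist_nonneg).2 ?_ |>.symm
    rw [← sq]
    refine le_antisymm ?_ ?_
    -- Four points bound the distance from below; `IsCAT0.cn` on the vertical segment through F q
    -- bounds it from above.
    · have h1 := hX.four_points (c.toFun (p 0)) (c.toFun (q 0)) (F q) (F p)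
      have h2 := hc_ge q hq (p 0)
      have h3 := hc_ge p hp (q 0)
      rw [dist_comm (c.toFun (p 0)) (F q), dist_comm (c.toFun (q 0)) (F p),
        dist_comm (c.toFun (q 0)) (F q), dist_comm (c.toFun (p 0)) (F p), hcF p hp, hcF q hq,
        c.dist_eq, sq_abs, dist_comm (F q) (F p)] at h1
      linarith
    · have h1 := hX.cn (F p) (hl _ hq) (hF q hq)
      have h2 := mul_le_mul_of_nonneg_left (hc_le p hp (q 0))
        (show 0 ≤ 1 - q 1 / w by linarith [(hl _ hq).2])
      have h3 := mul_le_mul_of_nonneg_left (he_le p hp (q 0)) (hl _ hq).1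
      rw [hwt] at h1
      have h4 : (1 - q 1 / w) * (p 1 ^ 2 + (p 0 - q 0) ^ 2) +
          q 1 / w * ((w - p 1) ^ 2 + (p 0 - q 0) ^ 2) - q 1 / w * (1 - q 1 / w) * w ^ 2 =
          (p 0 - q 0) ^ 2 + (p 1 - q 1) ^ 2 := by
        field_simp
        ring
      linarith
  · have hz : (!₂[t, 0] : EuclideanSpace ℝ (Fin 2)) 1 ∈ Icc 0 w := by simp [hw.le]
    have := hcF _ hz
    simp at this
    exact this

/-! ### Shadows, and segments passing near a geodesic that bounds no flat strip -/

/-- Pointwise limits of nearly isometric curves that stay close to a given curve. -/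
theorem exists_line_limit [ProperSpace X] {ι : Type*} (U : Ultrafilter ι) (γ : ι → ℝ → X)
    (d : ℝ → X) {C : ℝ} (h : ∀ t, ∀ᶠ i in (U : Filter ι), dist (γ i t) (d t) ≤ C)
    (hdist : ∀ s t, Tendsto (fun i => dist (γ i s) (γ i t)) U (𝓝 |s - t|)) :
    ∃ c : GeodesicLine X, (∀ t, Tendsto (fun i => γ i t) U (𝓝 (c.toFun t))) ∧
      ∀ t, dist (c.toFun t) (d t) ≤ C := by
  have hlim : ∀ t, ∃ x, dist x (d t) ≤ C ∧ Tendsto (fun i => γ i t) U (𝓝 x) := by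
    intro t
    obtain ⟨x, hx, hle⟩ := (isCompact_closedBall (d t) C).ultrafilter_le_nhds'
      (U.map fun i => γ i t) (h t)
    exact ⟨x, hx, hle⟩
  choose f hf hft using hlim
  refine ⟨⟨f, Isometry.of_dist_eq fun s t => ?_⟩, hft, hf⟩
  rw [Real.dist_eq]
  exact tendsto_nhds_unique ((hft s).dist (hft t)) (hdist s t)

/-- The union of all segments from `p` to `q`. -/
def segm (p q : X) : Set X := {z | dist p z + dist z q = dist p q}

theorem isCompact_segm [ProperSpace X] (p q : X) : IsCompact (segm p q) := by
  refine (isCompact_closedBall p (dist p q)).of_isClosed_subset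
    (isClosed_eq (by fun_prop) continuous_const) fun z hz => ?_
  have hz : dist p z + dist z q = dist p q := hz
  rw [Metric.mem_closedBall, dist_comm]
  linarith [dist_nonneg (x := z) (y := q)]

theorem segm_nonempty (p q : X) : (segm p q).Nonempty := ⟨p, by simp [segm]⟩

theorem IsCAT0.continuous_infDist_segm [ProperSpace X] (hX : IsCAT0 X) (o : X) :
    Continuous fun x : X × X => Metric.infDist o (segm x.1 x.2) := by
  refine (LipschitzWith.of_le_add_mul 2 fun x y => ?_).continuous
  obtain ⟨z, hz, hzd⟩ := (isCompact_segm y.1 y.2).exists_infDist_eq_dist (segm_nonempty _ _) o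
  obtain ⟨l, hl, hlz⟩ := exists_divPoint_of_dist_add hz
  obtain ⟨z', hz'⟩ := hX.exists_divPoint x.1 x.2 hl
  have h1 := hX.divPoint_dist_le hl hlz hz'
  have h2 : Metric.infDist o (segm x.1 x.2) ≤ dist o z' :=
    Metric.infDist_le_dist_of_mem hz'.dist_add
  have h3 : dist y.1 x.1 ≤ dist x y := by rw [dist_comm]; exact le_max_left _ _
  have h4 : dist y.2 x.2 ≤ dist x y := by rw [dist_comm]; exact le_max_right _ _
  have h5 := mul_le_mul_of_nonneg_left h3 (show 0 ≤ 1 - l by linarith [hl.2])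
  have h6 := mul_le_mul_of_nonneg_left h4 hl.1
  have h7 : 0 ≤ dist x y := dist_nonneg
  rw [hzd]
  push_cast
  linarith [dist_triangle o z z']

/-- The segment between two points is connected. -/
theorem IsCAT0.exists_preconnected (hX : IsCAT0 X) (p q : X) :
    ∃ s ⊆ segm p q, p ∈ s ∧ q ∈ s ∧ IsPreconnected s := by
  obtain ⟨c, hc⟩ := hX.geodesic p q
  have hcont : ContinuousOn c (Icc 0 (dist p q)) := by
    refine (LipschitzOnWith.of_dist_le_mul (K := 1) fun s hs t ht => ?_).continuousOn
    rw [hc.2.2 s hs t ht, Real.dist_eq]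
    simp
  refine ⟨c '' Icc 0 (dist p q), ?_, ⟨0, ⟨le_rfl, dist_nonneg⟩, hc.1⟩,
    ⟨_, ⟨dist_nonneg, le_rfl⟩, hc.2.1⟩, isPreconnected_Icc.image _ hcont⟩
  rintro _ ⟨t, ht, rfl⟩
  have h1 := hc.2.2 0 ⟨le_rfl, dist_nonneg⟩ t ht
  have h2 := hc.2.2 t ht (dist p q) ⟨dist_nonneg, le_rfl⟩
  rw [hc.1, zero_sub, abs_neg, abs_of_nonneg ht.1] at h1
  rw [hc.2.1, abs_sub_comm, abs_of_nonneg (by linarith [ht.2])] at h2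
  show dist p (c t) + dist (c t) q = dist p q
  linarith

/-- The points whose segment from `o` passes through the closed unit ball around `v`. -/
def shadow (o v : X) : Set X := {y | ∃ u ∈ segm o y, dist u v ≤ 1}

theorem mem_shadow_self (o v : X) : v ∈ shadow o v := ⟨v, by simp [segm], by simp⟩

/-- Each y is joined to v inside the shadow: from v to u within the unit ball, then outwards from u
to y. -/
theorem IsCAT0.isPreconnected_shadow (hX : IsCAT0 X) (o v : X) :
    IsPreconnected (shadow o v) := by
  refine isPreconnected_of_forall v fun y hy => ?_
  obtain ⟨u, hu, huv⟩ := hy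
  obtain ⟨s, hs, hus, hys, hsc⟩ := hX.exists_preconnected u y
  obtain ⟨t, ht, hvt, hut, htc⟩ := hX.exists_preconnected v u
  refine ⟨t ∪ s, ?_, Or.inl hvt, Or.inr hys, htc.union u hut hus hsc⟩
  rintro z (hz | hz)
  · have h1 : dist v z + dist z u = dist v u := ht hz
    refine ⟨z, by simp [segm], ?_⟩
    rw [dist_comm u v] at huv
    rw [dist_comm]
    linarith [dist_nonneg (x := z) (y := u)]
  · have h1 : dist u z + dist z y = dist u y := hs hz
    refine ⟨u, ?_, huv⟩
    simp only [segm, mem_ofPred_eq] at *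
    linarith [dist_triangle o z y, dist_triangle o u z]

/-- Moving the initial point from o to z moves the point at a fixed ratio by at most |oz|. -/
theorem IsCAT0.exists_near_of_mem_shadow (hX : IsCAT0 X) {o v p z : X} (hp : p ∈ shadow o v) :
    ∃ u ∈ segm z p, dist u v ≤ dist o z + 1 := by
  obtain ⟨u, hu, huv⟩ := hp
  obtain ⟨l, hl, hlu⟩ := exists_divPoint_of_dist_add hu
  obtain ⟨u', hu'⟩ := hX.exists_divPoint z p hl
  refine ⟨u', hu'.dist_add, ?_⟩
  have h1 := hX.divPoint_dist_le hl hu' hlu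
  rw [dist_self, mul_zero, add_zero, dist_comm z o] at h1
  have h2 : 0 ≤ l * dist o z := mul_nonneg hl.1 dist_nonneg
  linarith [dist_triangle u' u v]

/-- If some segment between the shadows of `c (-n)` and `c n` seen from `c 0` avoids a ball around
`c 0`, then some segment with endpoints close to `c (-n)` and `c n` touches it from outside. -/
theorem IsCAT0.exists_segm_avoiding [ProperSpace X] (hX : IsCAT0 X) (c : GeodesicLine X)
    {R n : ℝ} (hR : 0 < R) (hn : 0 ≤ n) {p q : X} (hp : p ∈ shadow (c.toFun 0) (c.toFun (-n)))
    (hq : q ∈ shadow (c.toFun 0) (c.toFun n)) (h : ∀ z ∈ segm p q, R < dist (c.toFun 0) z) :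
    ∃ u v, dist u (c.toFun (-n)) ≤ R + 1 ∧ dist v (c.toFun n) ≤ R + 1 ∧
      ∀ z ∈ segm u v, R ≤ dist (c.toFun 0) z := by
  set o := c.toFun 0 with ho
  have hconn := (hX.isPreconnected_shadow o (c.toFun (-n))).prod
    (hX.isPreconnected_shadow o (c.toFun n))
  -- On the product of the shadows, the distance from o to the segment grows continuously from 0 to
  -- at least R, so it equals R for some p', q'.
  have himage := hconn.intermediate_value
    (a := (c.toFun (-n), c.toFun n)) (b := (p, q))
    ⟨mem_shadow_self _ _, mem_shadow_self _ _⟩ ⟨hp, hq⟩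
    (hX.continuous_infDist_segm o).continuousOn
  have h0 : Metric.infDist o (segm (c.toFun (-n)) (c.toFun n)) ≤ R := by
    refine (Metric.infDist_le_dist_of_mem (y := o) ?_).trans (by rw [dist_self]; exact hR.le)
    show dist _ _ + dist _ _ = dist _ _
    rw [ho, c.dist_eq, c.dist_eq, c.dist_eq, abs_of_nonpos (by linarith),
      abs_of_nonpos (by linarith), abs_of_nonpos (by linarith)]
    ring
  have h1 : R ≤ Metric.infDist o (segm p q) := by
    obtain ⟨z, hz, hzd⟩ := (isCompact_segm p q).exists_infDist_eq_dist (segm_nonempty _ _) o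
    rw [hzd]
    exact (h z hz).le
  obtain ⟨⟨p', q'⟩, ⟨hp', hq'⟩, hpq⟩ := himage ⟨h0, h1⟩
  obtain ⟨z, hz, hzd⟩ := (isCompact_segm p' q').exists_infDist_eq_dist (segm_nonempty _ _) o
  have hpq : Metric.infDist o (segm p' q') = R := hpq
  rw [hpq] at hzd
  -- As |oz| = R, cutting the segment from p' to q' on both sides of z brings its ends within R + 1
  -- of c(±n).
  obtain ⟨u, hu, hu'⟩ := hX.exists_near_of_mem_shadow (z := z) hp'
  obtain ⟨v, hv, hv'⟩ := hX.exists_near_of_mem_shadow (z := z) hq'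
  refine ⟨u, v, by rw [hzd]; exact hu', by rw [hzd]; exact hv', fun y hy => ?_⟩
  rw [← hpq]
  refine Metric.infDist_le_dist_of_mem ?_
  simp only [segm, mem_ofPred_eq] at *
  rw [dist_comm z u, dist_comm u p', dist_comm z p'] at hu
  linarith [dist_triangle4 p' u y q', dist_triangle p' u y, dist_triangle y v q',
    dist_triangle p' y q', dist_triangle u z v]

/-- Segments with endpoints in the shadows of far away points of a geodesic that does not bound
a flat strip pass near its origin. -/
theorem IsCAT0.exists_segm_meets [ProperSpace X] (hX : IsCAT0 X) {c : GeodesicLine X}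
    (hc : ¬ c.BoundsFlatStrip) {R : ℝ} (hR : 0 < R) :
    ∃ n : ℕ, ∀ p ∈ shadow (c.toFun 0) (c.toFun (-(n + 1))),
      ∀ q ∈ shadow (c.toFun 0) (c.toFun (n + 1)),
      ∃ z ∈ segm p q, dist (c.toFun 0) z ≤ R := by
  by_contra! hbad
  have hex : ∀ n : ℕ, ∃ u v, dist u (c.toFun (-(n + 1))) ≤ R + 1 ∧
      dist v (c.toFun (n + 1)) ≤ R + 1 ∧ ∀ z ∈ segm u v, R ≤ dist (c.toFun 0) z := by
    intro n
    obtain ⟨p, hp, q, hq, h⟩ := hbad n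
    exact hX.exists_segm_avoiding c hR (by positivity) hp hq h
  choose u v hu hv huv using hex
  choose f hf using fun n => hX.geodesic (u n) (v n)
  -- The ratio at time t is that of c(t) between c(-(n+1)) and c(n+1), so γ stays within R + 1 of
  -- `c`, and its speed tends to 1.
  set γ : ℕ → ℝ → X := fun n t =>
    f n ((1 / 2 + t * (2 * ((n : ℝ) + 1))⁻¹) * dist (u n) (v n)) with hγ
  have hl : ∀ t : ℝ, ∀ᶠ n : ℕ in atTop, 1 / 2 + t * (2 * ((n : ℝ) + 1))⁻¹ ∈ Icc (0 : ℝ) 1 := by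
    intro t
    filter_upwards [tendsto_natCast_atTop_atTop.eventually_ge_atTop |t|] with n hn
    have h1 : |t * (2 * ((n : ℝ) + 1))⁻¹| ≤ 1 / 2 := by
      rw [abs_mul, abs_of_nonneg (a := (2 * ((n : ℝ) + 1))⁻¹) (by positivity), ← div_eq_mul_inv,
        div_le_iff₀ (by positivity)]
      linarith
    rw [abs_le] at h1
    exact ⟨by linarith, by linarith⟩
  have hdiv : ∀ t : ℝ, ∀ᶠ n : ℕ in atTop,
      DivPoint (1 / 2 + t * (2 * ((n : ℝ) + 1))⁻¹) (u n) (v n) (γ n t) := by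
    intro t
    filter_upwards [hl t] with n hn
    exact (hf n).divPoint hn
  have hU : (hyperfilter ℕ : Filter ℕ) ≤ atTop := Nat.hyperfilter_le_atTop
  have hspeed : Tendsto (fun n : ℕ => dist (u n) (v n) * (2 * ((n : ℝ) + 1))⁻¹) atTop (𝓝 1) := by
    have h1 : Tendsto (fun n : ℕ => (R + 1) * ((n : ℝ) + 1)⁻¹) atTop (𝓝 ((R + 1) * 0)) :=
      tendsto_const_nhds.mul (by simpa using tendsto_one_div_add_atTop_nhds_zero_nat (𝕜 := ℝ))
    rw [mul_zero] at h1
    have h2 := tendsto_const_nhds (x := (1 : ℝ)).sub h1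
    have h3 := tendsto_const_nhds (x := (1 : ℝ)).add h1
    rw [sub_zero] at h2
    rw [add_zero] at h3
    refine tendsto_of_tendsto_of_tendsto_of_le_of_le h2 h3 (fun n => ?_) fun n => ?_
    all_goals
      have hn : (0 : ℝ) < (n : ℝ) + 1 := by positivity
      have e1 := c.dist_eq (-((n : ℝ) + 1)) (n + 1)
      rw [abs_of_nonpos (by linarith)] at e1
      have e2 := dist_triangle4 (c.toFun (-((n : ℝ) + 1))) (u n) (v n) (c.toFun (n + 1))
      have e3 := dist_triangle4 (u n) (c.toFun (-((n : ℝ) + 1))) (c.toFun (n + 1)) (v n)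
      rw [dist_comm (c.toFun _) (u n)] at e2
      rw [dist_comm (c.toFun _) (v n)] at e3
      have e4 := hu n
      have e5 := hv n
      show _ ≤ _
      field_simp
      linarith
  obtain ⟨c', hc', hcc'⟩ := exists_line_limit (hyperfilter ℕ) γ c.toFun (C := R + 1)
    (fun t => by
      refine hU ?_
      filter_upwards [hdiv t, hl t] with n hn hln
      have hn0 : (0 : ℝ) < (n : ℝ) + 1 := by positivity
      have h1 := c.divPoint (-((n : ℝ) + 1)) (n + 1) hln
      rw [show (1 - (1 / 2 + t * (2 * ((n : ℝ) + 1))⁻¹)) * (-((n : ℝ) + 1)) +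
        (1 / 2 + t * (2 * ((n : ℝ) + 1))⁻¹) * (n + 1) = t by field_simp; ring] at h1
      have h2 := hX.divPoint_dist_le hln hn h1
      have h3 := mul_le_mul_of_nonneg_left (hu n) (sub_nonneg.2 hln.2)
      have h4 := mul_le_mul_of_nonneg_left (hv n) hln.1
      linarith)
    (fun s t => by
      have h1 := (hspeed.const_mul |s - t|).mono_left hU
      rw [mul_one] at h1
      refine h1.congr' (hU ?_)
      filter_upwards [hl s, hl t] with n hs ht
      have hd : 0 ≤ dist (u n) (v n) := dist_nonneg
      rw [hγ]
      simp only
      rw [(hf n).2.2 _ ⟨mul_nonneg hs.1 hd, mul_le_of_le_one_left hd hs.2⟩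
        _ ⟨mul_nonneg ht.1 hd, mul_le_of_le_one_left hd ht.2⟩, ← sub_mul, add_sub_add_left_eq_sub,
        ← sub_mul, abs_mul, abs_mul, abs_of_nonneg hd,
        abs_of_nonneg (a := (2 * ((n : ℝ) + 1))⁻¹) (by positivity)]
      ring)
  refine hc (hX.boundsFlatStrip (c' := c') (C := R + 1)
    (fun t => by rw [dist_comm]; exact hcc' t) ?_)
  rintro ⟨t, ht⟩
  have h1 : R ≤ dist (c.toFun 0) (c'.toFun t) := by
    refine ge_of_tendsto (tendsto_const_nhds.dist (hc' t)) (hU ?_)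
    filter_upwards [hdiv t] with n hn
    exact huv n _ hn.dist_add
  rw [ht, dist_self] at h1
  linarith

/-! ### Convergence in the cone topology -/

theorem coneNhd_mem_nhds (r : GeodesicRay X) {K : ℝ≥0} {ε : ℝ} (hK : 0 < K) (hε : 0 < ε) :
    coneNhd r.endpoint (r.toFun 0) K ε ∈ 𝓝 r.endpoint := by
  refine IsOpen.mem_nhds (TopologicalSpace.isOpen_generateFrom_of_mem
    ⟨_, _, _, _, hK, hε, rfl⟩) ?_
  exact ⟨r, r, rfl, rfl, rfl, rfl, by rwa [dist_self]⟩

theorem IsCAT0.exists_ray_of_mem_coneNhd (hX : IsCAT0 X) {r : GeodesicRay X} {K : ℝ≥0} {ε : ℝ}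
    {ξ : Boundary X} (h : ξ ∈ coneNhd r.endpoint (r.toFun 0) K ε) :
    ∃ s : GeodesicRay X, s.toFun 0 = r.toFun 0 ∧ s.endpoint = ξ ∧
      dist (r.toFun K) (s.toFun K) < ε := by
  obtain ⟨r', s, hr', hs, hr'e, hse, hd⟩ := h
  refine ⟨s, hs, hse, ?_⟩
  have := hX.dist_ray_le hr'e K
  rw [hr', dist_self] at this
  rwa [dist_le_zero.1 this] at hd

/-- Rays that are asymptotic to a ray near `r` remain near `r` for a long time. -/
theorem IsCAT0.eventually_dist_ray_le (hX : IsCAT0 X) {ι : Type*} {U : Filter ι}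
    {r : GeodesicRay X} {s : ι → GeodesicRay X} {C : ℝ}
    (h0 : ∀ᶠ i in U, dist (r.toFun 0) ((s i).toFun 0) ≤ C)
    (hs : Tendsto (fun i => (s i).endpoint) U (𝓝 r.endpoint)) (t : ℝ≥0) :
    ∀ᶠ i in U, dist ((s i).toFun t) (r.toFun t) ≤ C + 1 := by
  -- Cone neighbourhoods need a positive time, and t may be 0.
  have hK : 0 < t + 1 := by positivity
  filter_upwards [h0, hs (coneNhd_mem_nhds r hK one_pos)] with i hi0 hi
  obtain ⟨s', hs', hse, hd⟩ := hX.exists_ray_of_mem_coneNhd hi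
  have ht : t ≤ t + 1 := by simp
  have hl : (t : ℝ) / (t + 1 : ℝ≥0) ∈ Icc (0 : ℝ) 1 :=
    ⟨by positivity, div_le_one_of_le₀ (by exact_mod_cast ht) (by positivity)⟩
  have h1 := s'.divPoint ht hK
  rw [hs'] at h1
  have h2 := hX.divPoint_dist_le_of_left hl h1 (r.divPoint ht hK)
  rw [dist_comm] at hd
  have h3 := mul_le_mul hl.2 hd.le dist_nonneg zero_le_one
  have h4 := hX.dist_ray_le hse.symm t
  rw [hs', dist_comm _ (r.toFun 0)] at h4
  linarith [dist_triangle ((s i).toFun t) (s'.toFun t) (r.toFun t)]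

/-- The point at ratio K/t towards s(t) is within O(1/t) of s'(K), where s' is the ray from r(0)
asymptotic to s. The two errors 1/2 add up to the radius 1 of the shadow. -/
theorem IsCAT0.eventually_mem_shadow (hX : IsCAT0 X) {r s : GeodesicRay X} {K : ℝ≥0}
    (hK : 0 < K) (hs : s.endpoint ∈ coneNhd r.endpoint (r.toFun 0) K (1 / 2)) :
    ∀ᶠ t in atTop, s.toFun t ∈ shadow (r.toFun 0) (r.toFun K) := by
  obtain ⟨s', hs', hse, hd⟩ := hX.exists_ray_of_mem_coneNhd hs
  have h1 : Tendsto (fun t : ℝ≥0 => (K : ℝ) * dist (s'.toFun 0) (s.toFun 0) * (t : ℝ)⁻¹) atTop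
      (𝓝 (K * dist (s'.toFun 0) (s.toFun 0) * 0)) := tendsto_const_nhds.mul tendsto_nnreal_inv
  rw [mul_zero] at h1
  filter_upwards [eventually_ge_atTop K, h1.eventually_le_const (show (0 : ℝ) < 1 / 2 by norm_num)]
    with t hKt ht
  have ht0 : 0 < t := hK.trans_le hKt
  have hl : (K : ℝ) / t ∈ Icc (0 : ℝ) 1 :=
    ⟨by positivity, div_le_one_of_le₀ (by exact_mod_cast hKt) (by positivity)⟩
  obtain ⟨u, hu⟩ := hX.exists_divPoint (r.toFun 0) (s.toFun t) hl
  refine ⟨u, hu.dist_add, ?_⟩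
  have h2 := s'.divPoint hKt ht0
  rw [hs'] at h2
  have h3 := hX.divPoint_dist_le_of_left hl hu h2
  have h4 := mul_le_mul_of_nonneg_left (hX.dist_ray_le hse t) hl.1
  rw [dist_comm (s.toFun t)] at h3
  have h5 : (K : ℝ) / t * dist (s'.toFun 0) (s.toFun 0) =
      K * dist (s'.toFun 0) (s.toFun 0) * (t : ℝ)⁻¹ := by ring
  rw [dist_comm] at hd
  linarith [dist_triangle u (s'.toFun K) (r.toFun K)]

theorem IsCAT0.segm_subset_image (hX : IsCAT0 X) (c : GeodesicLine X) (s t : ℝ) :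
    segm (c.toFun s) (c.toFun t) ⊆ c.image := by
  intro z hz
  obtain ⟨l, hl, hlz⟩ := exists_divPoint_of_dist_add hz
  rw [hX.divPoint_unique hl hlz (c.divPoint s t hl)]
  exact ⟨_, rfl⟩

/-- Complete geodesics whose ends converge to the ends of a complete geodesic that does not bound
a flat strip eventually pass near its origin. -/
theorem IsCAT0.eventually_exists_near [ProperSpace X] (hX : IsCAT0 X) {c : GeodesicLine X}
    (hc : ¬ c.BoundsFlatStrip) {ι : Type*} {U : Filter ι} {e : ι → GeodesicLine X}
    (hpos : Tendsto (fun i => (e i).posEnd) U (𝓝 c.posEnd))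
    (hneg : Tendsto (fun i => (e i).negEnd) U (𝓝 c.negEnd)) :
    ∀ᶠ i in U, ∃ u, dist (c.toFun 0) ((e i).toFun u) ≤ 1 := by
  obtain ⟨n, hn⟩ := hX.exists_segm_meets hc one_pos
  have hK : (0 : ℝ≥0) < n + 1 := by positivity
  filter_upwards [hpos (coneNhd_mem_nhds c.posRay hK one_half_pos),
    hneg (coneNhd_mem_nhds c.negRay hK one_half_pos)] with i hi1 hi2
  obtain ⟨t, ht1, ht2⟩ := ((hX.eventually_mem_shadow hK hi1).and
    (hX.eventually_mem_shadow hK hi2)).exists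
  simp only [GeodesicLine.posRay, GeodesicLine.negRay, NNReal.coe_zero, neg_zero, NNReal.coe_add,
    NNReal.coe_natCast, NNReal.coe_one] at ht1 ht2
  obtain ⟨z, hz, hzd⟩ := hn _ ht2 _ ht1
  obtain ⟨u, rfl⟩ := hX.segm_subset_image _ _ _ hz
  exact ⟨u, hzd⟩

/-! ### Continuity of Busemann sums and of the displacement -/

/-- Busemann functions depend continuously on the ray. -/
theorem IsCAT0.tendsto_busemann_of_tendsto (hX : IsCAT0 X) {ι : Type*} {U : Filter ι}
    {r : ι → GeodesicRay X} {s : GeodesicRay X} {x : ι → X} {y : X}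
    (hr : ∀ t, Tendsto (fun i => (r i).toFun t) U (𝓝 (s.toFun t))) (hx : Tendsto x U (𝓝 y)) :
    Tendsto (fun i => busemann (r i) (x i)) U (𝓝 (busemann s y)) := by
  refine tendsto_order.2 ⟨fun b hb => ?_, fun b hb => ?_⟩
  -- `IsCAT0.le_busemann` bounds the Busemann function below, and `busemann_le` above, by distances
  -- at one finite time t; both bounds pass to the limit in i.
  · have h1 := (tendsto_busemann_sq s y).sub
      ((tendsto_nnreal_inv.const_mul (dist y (s.toFun 0) ^ 2 / 2)))
    rw [mul_zero, sub_zero] at h1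
    obtain ⟨t, ht, ht0⟩ := ((h1.eventually_const_lt hb).and (eventually_gt_atTop 0)).exists
    have ht0' : (0 : ℝ) < t := by exact_mod_cast ht0
    have h2 : Tendsto (fun i => (dist (x i) ((r i).toFun t) ^ 2 - (t : ℝ) ^ 2) * (2 * (t : ℝ))⁻¹
        - dist (x i) ((r i).toFun 0) ^ 2 / 2 * (t : ℝ)⁻¹) U (𝓝 _) :=
      ((((hx.dist (hr t)).pow 2).sub_const _).mul_const _).sub
        ((((hx.dist (hr 0)).pow 2).div_const 2).mul_const _)
    filter_upwards [h2.eventually_const_lt ht] with i hi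
    refine hi.trans_le ?_
    have h3 := hX.le_busemann (r i) (x i) t
    have h4 : (dist (x i) ((r i).toFun t) ^ 2 - (t : ℝ) ^ 2) * (2 * (t : ℝ))⁻¹
        - dist (x i) ((r i).toFun 0) ^ 2 / 2 * (t : ℝ)⁻¹ =
        (dist (x i) ((r i).toFun t) ^ 2 - (t : ℝ) ^ 2 - dist (x i) ((r i).toFun 0) ^ 2) /
          (2 * t) := by
      field_simp
    rw [h4, div_le_iff₀ (by positivity)]
    linarith
  · obtain ⟨t, ht⟩ := ((tendsto_busemann s y).eventually_lt_const hb).exists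
    filter_upwards [((hx.dist (hr t)).sub_const (t : ℝ)).eventually_lt_const ht] with i hi
    exact (busemann_le (r i) (x i) t).trans_lt hi

/-- Only the ends matter, so the approximating geodesics may be shifted to start near c(0), and
their limit, a parallel of `c`, may replace `c`. -/
theorem IsCAT0.tendsto_busemannSum [ProperSpace X] (hX : IsCAT0 X) {c : GeodesicLine X}
    (hc : ¬ c.BoundsFlatStrip) {ι : Type*} {U : Ultrafilter ι} {e : ι → GeodesicLine X}
    {x : ι → X} {y : X} (hpos : Tendsto (fun i => (e i).posEnd) U (𝓝 c.posEnd))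
    (hneg : Tendsto (fun i => (e i).negEnd) U (𝓝 c.negEnd)) (hx : Tendsto x U (𝓝 y)) :
    Tendsto (fun i => (e i).busemannSum (x i)) U (𝓝 (c.busemannSum y)) := by
  have hex : ∀ i, ∃ u, (∃ u, dist (c.toFun 0) ((e i).toFun u) ≤ 1) →
      dist (c.toFun 0) ((e i).toFun u) ≤ 1 := by
    intro i
    by_cases h : ∃ u, dist (c.toFun 0) ((e i).toFun u) ≤ 1
    · exact ⟨h.choose, fun _ => h.choose_spec⟩
    · exact ⟨0, fun h' => absurd h' h⟩
  choose u hu using hex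
  set f : ι → GeodesicLine X := fun i => (e i).shift (u i) with hf
  have hfpos : ∀ i, (f i).posEnd = (e i).posEnd := fun i => (e i).shift_posEnd (u i)
  have hfneg : ∀ i, (f i).negEnd = (e i).negEnd := fun i => (e i).shift_negEnd (u i)
  simp only [← hfpos] at hpos
  simp only [← hfneg] at hneg
  have hsum : ∀ i, (e i).busemannSum (x i) = (f i).busemannSum (x i) := fun i =>
    (hX.busemannSum_eq (hfpos i) (hfneg i) (x i)).symm
  simp only [hsum]
  have h0 : ∀ᶠ i in (U : Filter ι), dist (c.toFun 0) ((f i).toFun 0) ≤ 1 := by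
    simp only [hfpos] at hpos
    simp only [hfneg] at hneg
    filter_upwards [hX.eventually_exists_near hc hpos hneg] with i hi
    simpa [hf, GeodesicLine.shift] using hu i hi
  have hbound : ∀ t, ∀ᶠ i in (U : Filter ι), dist ((f i).toFun t) (c.toFun t) ≤ 1 + 1 := by
    intro t
    rcases le_total 0 t with ht | ht
    · exact hX.eventually_dist_ray_le (r := c.posRay) (s := fun i => (f i).posRay) h0 hpos ⟨t, ht⟩
    · obtain ⟨s, rfl⟩ : ∃ s : ℝ≥0, t = -s := ⟨⟨-t, by linarith⟩, (neg_neg t).symm⟩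
      exact hX.eventually_dist_ray_le (r := c.negRay) (s := fun i => (f i).negRay)
        (by simpa [GeodesicLine.negRay] using h0) hneg s
  obtain ⟨d, hd, hdc⟩ := exists_line_limit U (fun i => (f i).toFun) c.toFun hbound fun s t => by
    simp only [GeodesicLine.dist_eq]
    exact tendsto_const_nhds
  have hdpos : d.posEnd = c.posEnd := GeodesicRay.endpoint_eq_iff.2 ⟨1 + 1, fun t => hdc t⟩
  have hdneg : d.negEnd = c.negEnd := GeodesicRay.endpoint_eq_iff.2 ⟨1 + 1, fun t => hdc (-t)⟩
  rw [← hX.busemannSum_eq hdpos hdneg]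
  exact (hX.tendsto_busemann_of_tendsto (fun t => hd t) hx).add
    (hX.tendsto_busemann_of_tendsto (fun t => hd (-t)) hx)

theorem GeodesicLine.asymptotic_of_posEnd_eq {c c' : GeodesicLine X}
    (h : c.posEnd = c'.posEnd) : c.Asymptotic c' :=
  ⟨c.posRay, c'.posRay, range_subset_iff.2 fun _ => ⟨_, rfl⟩, range_subset_iff.2 fun _ => ⟨_, rfl⟩,
    Quotient.exact h⟩

theorem GeodesicLine.asymptotic_of_negEnd_eq {c c' : GeodesicLine X}
    (h : c.negEnd = c'.negEnd) : c.Asymptotic c' :=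
  ⟨c.negRay, c'.negRay, range_subset_iff.2 fun _ => ⟨_, rfl⟩, range_subset_iff.2 fun _ => ⟨_, rfl⟩,
    Quotient.exact h⟩

/-- The chain a, c, d consists of consecutively asymptotic geodesics. -/
theorem IsScissors.not_boundsFlatStrip {a b c d : GeodesicLine X} {x : X}
    (h : IsScissors a b c d x) (ha : a.StrictlyRankOne) : ¬ d.BoundsFlatStrip := fun hd =>
  ha ⟨d, (Relation.ReflTransGen.single (GeodesicLine.asymptotic_of_posEnd_eq h.a_pos_c)).tail
    (GeodesicLine.asymptotic_of_negEnd_eq h.c_neg_d), hd⟩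

open Classical in
/-- The displacement of scissors translations with lowest base `a`, as a function of the triple
formed by two boundary points and the center. -/
noncomputable def displacement (a : GeodesicLine X) (z : Boundary X × Boundary X × X) : ℝ :=
  if h : ∃ d : GeodesicLine X, d.posEnd = z.1 ∧ d.negEnd = z.2.1 then
    a.busemannSum z.2.2 + h.choose.busemannSum z.2.2
  else 0

theorem IsCAT0.displacement_eq (hX : IsCAT0 X) (a : GeodesicLine X) {d : GeodesicLine X}
    {z : Boundary X × Boundary X × X} (h1 : d.posEnd = z.1) (h2 : d.negEnd = z.2.1) :
    displacement a z = a.busemannSum z.2.2 + d.busemannSum z.2.2 := by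
  have h : ∃ d : GeodesicLine X, d.posEnd = z.1 ∧ d.negEnd = z.2.1 := ⟨d, h1, h2⟩
  rw [displacement, dif_pos h, hX.busemannSum_eq (h.choose_spec.1.trans h1.symm)
    (h.choose_spec.2.trans h2.symm)]

theorem IsCAT0.continuousOn_displacement [ProperSpace X] (hX : IsCAT0 X) {a : GeodesicLine X}
    (ha : a.StrictlyRankOne) : ContinuousOn (displacement a) (scissorsTriples a) := by
  have hline : ∀ z : Boundary X × Boundary X × X, ∃ d : GeodesicLine X, z ∈ scissorsTriples a →
      d.posEnd = z.1 ∧ d.negEnd = z.2.1 ∧ ¬ d.BoundsFlatStrip := by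
    intro z
    by_cases hz : z ∈ scissorsTriples a
    · obtain ⟨b, c, d, h, hb, hc⟩ := hz
      exact ⟨d, fun _ => ⟨h.b_pos_d.symm.trans hb, h.c_neg_d.symm.trans hc,
        h.not_boundsFlatStrip ha⟩⟩
    · exact ⟨a, fun h => absurd h hz⟩
  choose D hD using hline
  intro z hz
  -- Along an ultrafilter, properness yields limit geodesics without passing to subsequences.
  refine (tendsto_iff_ultrafilter _ _ _).2 fun U hU => ?_
  have hmem : ∀ᶠ z' in (U : Filter _), z' ∈ scissorsTriples a := hU self_mem_nhdsWithin
  have hlim : Tendsto id (U : Filter _) (𝓝 z) := hU.trans nhdsWithin_le_nhds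
  have hx : Tendsto (fun z' : Boundary X × Boundary X × X => z'.2.2) U (𝓝 z.2.2) :=
    hlim.snd_nhds.snd_nhds
  have hpos : Tendsto (fun z' => (D z').posEnd) U (𝓝 (D z).posEnd) := by
    rw [(hD z hz).1]
    refine hlim.fst_nhds.congr' ?_
    filter_upwards [hmem] with z' hz'
    exact (hD z' hz').1.symm
  have hneg : Tendsto (fun z' => (D z').negEnd) U (𝓝 (D z).negEnd) := by
    rw [(hD z hz).2.1]
    refine hlim.snd_nhds.fst_nhds.congr' ?_
    filter_upwards [hmem] with z' hz'
    exact (hD z' hz').2.1.symm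
  rw [hX.displacement_eq a (hD z hz).1 (hD z hz).2.1]
  refine Tendsto.congr' ?_ (((a.continuous_busemannSum.tendsto _).comp hx).add
    (hX.tendsto_busemannSum (hD z hz).2.2 hpos hneg hx))
  filter_upwards [hmem] with z' hz'
  exact (hX.displacement_eq a (hD z' hz').1 (hD z' hz').2.1).symm

end CAT0

end Scissors

theorem mainTheorem6 {X : Type*} [MetricSpace X] [LocallyCompactSpace X]
    (hX : Scissors.IsCAT0 X) (hgc : Scissors.GeodesicallyComplete X)
    (hinf : Scissors.ConnectedAtInfinity X)
    (a : Scissors.GeodesicLine X) (ha : a.StrictlyRankOne) :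
    ∃ δ : Scissors.Boundary X × Scissors.Boundary X × X → ℝ,
      (∀ (b c d : Scissors.GeodesicLine X) (x : X), Scissors.IsScissors a b c d x →
        ∀ m ∈ a.image, Scissors.displacementAt a b c d m = δ (b.posEnd, c.negEnd, x)) ∧
      ContinuousOn δ (Scissors.scissorsTriples a) := by
  have := hX.properSpace
  refine ⟨Scissors.displacement a, fun b c d x h m hm => ?_, hX.continuousOn_displacement ha⟩
  rw [hX.displacementAt_eq h hm, hX.displacement_eq a h.b_pos_d.symm h.c_neg_d.symm]
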